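/- Let $q$ be a prime power, let $K\subseteq\mathbb Z_{\ge 1}$ be a finite set, and fix a nontrivial homomorphism $\vartheta:\mathbb F_q^+\to\mathbb C^\times$. **Arcs.** An arc on $K$ is a triple $i\overset{a}{\frown} l$ with $i,l\in K$, $i<l$ and $a\in\mathbb F_q^\times$. A $q$-set partition of $K$ is a finite multiset of arcs on $K$ in which no two arcs (counted with multiplicity) have the same left endpoint or the same right endpoint. For a multiset $\gamma$ of arcs, let $\bar\gamma$ be obtained by negating all labels, let $m_{jk}(\gamma)$ be the number of arcs of $\gamma$ from $j$ to $k$ (with multiplicity), and let $\mathrm{wt}_{jk}(\gamma)\in\mathbb F_q$ be the sum of their labels. Unions of multisets add multiplicities. **Supercharacters.** Let $U_K(q)$ be the group of unipotent upper-triangular matrices over $\mathbb F_q$ with rows and columns indexed by $K$. Its superclasses are the sets $1+U_K(q)\,e_\gamma\,U_K(q)$, where $\gamma$ is a $q$-set partition of $K$ and $e_\gamma$ has $(j,k)$ entry $\mathrm{wt}_{jk}(\gamma)$; they partition $U_K(q)$. For a $q$-set partition $\lambda$ of $K$ put $\chi^\lambda=\prod_{i\overset{a}{\frown}l\,\in\lambda}\chi^{i\overset{a}{\frown}l}$,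 where the value of $\chi^{i\overset{a}{\frown}l}$ on the superclass of $\gamma$ is $0$ if $\gamma$ contains an arc $j\overset{b}{\frown}k$ with $i=j$, $k<l$ or with $i<j$, $k=l$, and otherwise is $$\frac{q^{|\{j\in K\,:\,i<j<l\}|}}{q^{|\{j\overset{b}{\frown}k\,\in\gamma\,:\,i<j,\ k<l\}|}}\ \vartheta\bigl(a\,\mathrm{wt}_{il}(\gamma)\bigr).$$ Let $\langle f,g\rangle=|U_K(q)|^{-1}\sum_{u\in U_K(q)}f(u)\overline{g(u)}$. **The graph.** Let $\gamma$ be a finite multiset of arcs. Stack the coinciding endpoints of its arcs as follows. Among the arcs starting at $i$, those with larger right endpoint start higher. Among the arcs ending at $k$, those with smaller left endpoint end higher. Enumerate the $m=m_{jk}(\gamma)$ arcs from $j$ to $k$ (in any order) as $\alpha_1,\dots,\alpha_m$; their right endpoints have increasing heights $1,\dots,m$ in this order, and so do their left endpoints, except that if $m>1$ and $\mathrm{wt}_{jk}(\gamma)=0$, then the left endpoint of $\alpha_m$ has height $m-1$ and that of $\alpha_{m-1}$ has height $m$. The label $\Lambda_K(\alpha)\in\{\circ,\bullet\}^2$ of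 an arc $\alpha$ from $j$ to $k$ has first entry $\circ$ if $j\notin K$ or $\alpha$ starts below another arc that starts at $j$, and $\bullet$ otherwise; its second entry is $\circ$ if $k\notin K$ or $\alpha$ ends below another arc that ends at $k$, and $\bullet$ otherwise. Let $V_\bullet$ and $V_\circ$ be the sets of arcs of $\gamma$ (with multiplicity) labelled $(\bullet,\bullet)$ and $(\circ,\circ)$, respectively. The bipartite graph $\Gamma_K(\gamma)$ has vertex set $V_\bullet\sqcup V_\circ$, and an arc from $i$ to $l$ in $V_\circ$ is joined to an arc from $j$ to $k$ in $V_\bullet$ exactly when $i<j<k<l$. **Theorem.** Let $\lambda,\mu,\nu$ be $q$-set partitions of $K$. Then, whatever enumeration of the parallel arcs is chosen, $$\langle\chi^\lambda\otimes\chi^\mu,\chi^\nu\rangle\neq 0$$ if and only if $\Gamma_K(\lambda\cup\mu\cup\bar\nu)$ has a matching that covers $V_\bullet$. -/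

import Mathlib

namespace UnitriSuper

/-- An arc from `src` to `tgt` (with `src < tgt`) labelled by a nonzero element of `F`. -/
structure Arc (F : Type*) [Field F] where
  src : ℕ+
  tgt : ℕ+
  src_lt_tgt : src < tgt
  label : Fˣ

variable {F : Type*} [Field F]

/-- The arc with the same endpoints and the negated label. -/
def Arc.bar (α : Arc F) : Arc F := { α with label := -α.label }

/-- The multiset obtained from `M` by negating all labels. -/
def bar (M : Multiset (Arc F)) : Multiset (Arc F) := M.map Arc.bar

/-- The sum of the labels of the arcs of `M` (with multiplicity) from `j` to `k`. -/
def wt (M : Multiset (Arc F)) (j k : ℕ+) : F :=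
  ((M.filter fun α => α.src = j ∧ α.tgt = k).map fun α => (α.label : F)).sum

/-- `M` is a `q`-set partition of `K`: a multiset of arcs with all endpoints in `K`, no two of whose
arcs (counted with multiplicity) have the same left endpoint or the same right endpoint. -/
structure IsQSetPartition (K : Finset ℕ+) (M : Multiset (Arc F)) : Prop where
  src_mem : ∀ α ∈ M, α.src ∈ K
  tgt_mem : ∀ α ∈ M, α.tgt ∈ K
  src_nodup : (M.map Arc.src).Nodup
  tgt_nodup : (M.map Arc.tgt).Nodup

section Group

variable (F)

/-- The group of unipotent upper-triangular matrices over `F` with rows and columns indexed by `K`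
(in increasing order). -/
def unitri (K : Finset ℕ+) : Subgroup (GL K F) where
  carrier := {g | (g : Matrix K K F).IsUpperTriangular ∧ ∀ i, (g : Matrix K K F) i i = 1}
  one_mem' := ⟨by simpa using Matrix.blockTriangular_one, by simp⟩
  mul_mem' := by
    rintro a b ⟨ha, ha'⟩ ⟨hb, hb'⟩
    refine ⟨by simpa using Matrix.BlockTriangular.mul ha hb, fun i => ?_⟩
    rw [Units.val_mul, Matrix.mul_apply, Finset.sum_eq_single i, ha', hb', one_mul]
    · intro j _ hj
      rcases lt_or_gt_of_ne hj with h | h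
      · rw [ha h, zero_mul]
      · rw [hb h, mul_zero]
    · simp
  inv_mem' := by
    rintro a ⟨ha, ha'⟩
    have hi : ((a⁻¹ : GL K F) : Matrix K K F).IsUpperTriangular := by
      have : Invertible (a : Matrix K K F) := a.invertible
      rw [Matrix.coe_units_inv]
      exact Matrix.blockTriangular_inv_of_blockTriangular ha
    refine ⟨hi, fun i => ?_⟩
    have h : ((a : Matrix K K F) * ((a⁻¹ : GL K F) : Matrix K K F)) i i = 1 := by
      rw [← Units.val_mul, mul_inv_cancel]; simp
    rw [Matrix.mul_apply, Finset.sum_eq_single i, ha', one_mul] at h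
    · exact h
    · intro j _ hj
      rcases lt_or_gt_of_ne hj with h | h
      · rw [ha h, zero_mul]
      · rw [hi h, mul_zero]
    · simp

end Group

/-- The matrix `∑ a E_{jk}`, summed over the arcs from `j` to `k` with label `a` in `μ`. -/
def arcMatrix (K : Finset ℕ+) (μ : Multiset (Arc F)) : Matrix K K F :=
  Matrix.of fun j k => wt μ j k

/-- `u` lies in the superclass `1 + U e U`, where `U` is the unitriangular group and `e` is the
matrix of `μ`. -/
def InSuperclass (K : Finset ℕ+) (μ : Multiset (Arc F)) (u : unitri F K) : Prop :=
  ∃ x y : unitri F K, ((u : GL K F) : Matrix K K F) =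
    1 + ((x : GL K F) : Matrix K K F) * arcMatrix K μ * ((y : GL K F) : Matrix K K F)

/-- The `q`-set partition of `K` that indexes the superclass of `u` (every `u` lies in exactly one
superclass with such an index). -/
noncomputable def superclassIndex (K : Finset ℕ+) (u : unitri F K) : Multiset (Arc F) :=
  Classical.epsilon fun μ => IsQSetPartition K μ ∧ InSuperclass K μ u

section Characters

variable [Fintype F] (θ : AddChar F ℂ)

open Classical in
/-- The value of the supercharacter of a single arc `α` on the superclass indexed by `μ`. -/
noncomputable def arcValue (K : Finset ℕ+) (α : Arc F) (μ : Multiset (Arc F)) : ℂ :=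
  if ∃ β ∈ μ, (α.src = β.src ∧ β.tgt < α.tgt) ∨ (α.src < β.src ∧ β.tgt = α.tgt) then 0
  else
    ((Fintype.card F : ℂ) ^ (K.filter fun j => α.src < j ∧ j < α.tgt).card /
      (Fintype.card F : ℂ) ^ (μ.filter fun β => α.src < β.src ∧ β.tgt < α.tgt).card) *
      θ ((α.label : F) * wt μ α.src α.tgt)

/-- The (super)character of the unitriangular group on `K` attached to a multiset `M` of arcs: the
product of the supercharacters of its arcs. -/
noncomputable def superchar (K : Finset ℕ+) (M : Multiset (Arc F)) : unitri F K → ℂ :=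
  fun u => (M.map fun α => arcValue θ K α (superclassIndex K u)).prod

end Characters

/-- The usual inner product of complex functions on a finite group. -/
noncomputable def charInner {G : Type*} [Group G] [Finite G] (f g : G → ℂ) : ℂ :=
  (Nat.card G : ℂ)⁻¹ * ∑ᶠ u : G, f u * (starRingEnd ℂ) (g u)

/-! ### The perturbed arc diagram

A multiset of arcs is presented as a list `D`; the indices `x : Fin D.length` are the arcs (with
multiplicity), and parallel arcs `a₁, …, aₘ` are enumerated in the order of the list. -/

section Diagram

/-- `x` and `y` have the same endpoints. -/
def Parallel (D : List (Arc F)) (x y : Fin D.length) : Prop :=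
  (D.get x).src = (D.get y).src ∧ (D.get x).tgt = (D.get y).tgt

open Classical in
/-- The number of arcs parallel to `x`, including `x`. -/
noncomputable def mult (D : List (Arc F)) (x : Fin D.length) : ℕ :=
  (Finset.univ.filter fun y => Parallel D y x).card

open Classical in
/-- The position (from `1` to `mult D x`) of `x` among the arcs parallel to it. -/
noncomputable def pos (D : List (Arc F)) (x : Fin D.length) : ℕ :=
  (Finset.univ.filter fun y => Parallel D y x ∧ y ≤ x).card

open Classical in
/-- The height of the left endpoint of `x` among the arcs parallel to `x`: parallel arcs are stacked
in order, except that the left endpoints of the last two are interchanged when there are at least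
two parallel arcs and their labels sum to zero. -/
noncomputable def leftHeight (D : List (Arc F)) (x : Fin D.length) : ℕ :=
  if 1 < mult D x ∧ wt (D : Multiset (Arc F)) (D.get x).src (D.get x).tgt = 0 then
    if pos D x = mult D x then mult D x - 1
    else if pos D x = mult D x - 1 then mult D x
    else pos D x
  else pos D x

/-- The height of the right endpoint of `x` among the arcs parallel to `x`. -/
noncomputable def rightHeight (D : List (Arc F)) (x : Fin D.length) : ℕ := pos D x

/-- `x` and `y` start at the same node, and `x` starts below `y`. -/
def StartsBelow (D : List (Arc F)) (x y : Fin D.length) : Prop :=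
  (D.get x).src = (D.get y).src ∧
    ((D.get x).tgt < (D.get y).tgt ∨
      ((D.get x).tgt = (D.get y).tgt ∧ leftHeight D x < leftHeight D y))

/-- `x` and `y` end at the same node, and `x` ends below `y`. -/
def EndsBelow (D : List (Arc F)) (x y : Fin D.length) : Prop :=
  (D.get x).tgt = (D.get y).tgt ∧
    ((D.get y).src < (D.get x).src ∨
      ((D.get x).src = (D.get y).src ∧ rightHeight D x < rightHeight D y))

/-- The two marks `•` and `∘` for an endpoint of an arc. -/
inductive Mark
  | filled
  | hollow

open Classical in
/-- The labelling `Λ_K` of the arcs by pairs of marks. -/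
noncomputable def marks (K : Finset ℕ+) (D : List (Arc F)) (x : Fin D.length) : Mark × Mark :=
  (if (D.get x).src ∉ K ∨ ∃ y, StartsBelow D x y then Mark.hollow else Mark.filled,
   if (D.get x).tgt ∉ K ∨ ∃ y, EndsBelow D x y then Mark.hollow else Mark.filled)

/-- The vertices `V_•`: arcs labelled `(•, •)`. -/
abbrev FilledVertex (K : Finset ℕ+) (D : List (Arc F)) : Type :=
  {x : Fin D.length // marks K D x = (Mark.filled, Mark.filled)}

/-- The vertices `V_∘`: arcs labelled `(∘, ∘)`. -/
abbrev HollowVertex (K : Finset ℕ+) (D : List (Arc F)) : Type :=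
  {x : Fin D.length // marks K D x = (Mark.hollow, Mark.hollow)}

/-- The arc `y` is strictly nested inside the arc `x`. -/
def Nested (D : List (Arc F)) (y x : Fin D.length) : Prop :=
  (D.get x).src < (D.get y).src ∧ (D.get y).tgt < (D.get x).tgt

/-- The bipartite graph `Γ_K` on `V_• ⊔ V_∘`: an arc in `V_•` is joined to the arcs in `V_∘` inside
which it is strictly nested. -/
def diagramGraph (K : Finset ℕ+) (D : List (Arc F)) :
    SimpleGraph (FilledVertex K D ⊕ HollowVertex K D) where
  Adj
    | Sum.inl y, Sum.inr x => Nested D y.1 x.1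
    | Sum.inr x, Sum.inl y => Nested D y.1 x.1
    | _, _ => False
  symm := ⟨by rintro (a | a) (b | b) h <;> exact h⟩
  loopless := ⟨by rintro (a | a) h <;> exact h⟩

/-- `Γ_K` has a matching that covers `V_•`. -/
def HasCompleteMatching (K : Finset ℕ+) (D : List (Arc F)) : Prop :=
  ∃ M : (diagramGraph K D).Subgraph, M.IsMatching ∧ ∀ y : FilledVertex K D, Sum.inl y ∈ M.verts

end Diagram

end UnitriSuper

open Finset Matrix

/-! Conjugation negates labels, so the inner product is the average over the group U of the product
of the arc characters in λ ∪ μ ∪ ν̄. Up to a nonzero constant, the character of an arc from i to l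
with label a is the sum of θ(a pᵀ(u - 1)q) over all p whose first nonzero entry is a 1 at i and all
q whose last nonzero entry is a 1 at l (`exists_arcValue_eq_mul_orbitSum`). Expanding the product
and summing over u leaves |U| times the number of families (p_x, q_x) for which ∑ a_x p_x q_xᵀ
vanishes above the diagonal. Nothing cancels, so the question is whether this bilinear system is
solvable (`sum_superchar_ne_zero_iff`).

Read the system node by node. P_j is the sum of the unit vectors of the arcs starting at j, plus a
free combination of arcs starting before j; Q_k is the sum over the arcs ending at k, plus a free
combination of arcs ending after k; and P_j ⟂ Q_k for j < k, in the form with coefficients a_x. A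
change of basis compatible with both filtrations replaces the two prescribed sums by multiples of
single basis vectors, those of the arc starting highest at j (`top`) and of the arc ending highest
at k (`bot`). The interchange of left ends in classes of weight zero is what makes such a basis
exist (`exists_isSolution_iff_exists_isReducedSolution`).

Now only filled arcs obstruct orthogonality. Hollow arcs matched to them supply free coordinates
that cancel the obstructions; conversely, a dimension count turns a solution into Hall's condition
(`card_le_card_hollow_of_isReducedSolution`). -/

/-! ### Linear algebra: the basis adapted to an arc system. -/

theorem mulVec_eq_zero_of_blockTriangular {ι κ F : Type*} [Fintype ι]
    [LinearOrder κ] [Field F] {A : Matrix ι ι F} {b : ι → κ} (hA : A.BlockTriangular b)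
    {j : κ} {u : ι → F} (hu : ∀ x, ¬ b x < j → u x = 0) (x : ι) (hx : ¬ b x < j) :
    (A *ᵥ u) x = 0 := by
  refine sum_eq_zero fun y _ => ?_
  dsimp only
  by_cases h : b y < b x
  · rw [hA h, zero_mul]
  · rw [hu y (fun h' => hx ((not_lt.1 h).trans_lt h')), mul_zero]

theorem vecMul_eq_zero_of_blockTriangular {ι κ F : Type*} [Fintype ι]
    [LinearOrder κ] [Field F] {A : Matrix ι ι F} {b : ι → κ} (hA : A.BlockTriangular b)
    {k : κ} {u : ι → F} (hu : ∀ x, ¬ k < b x → u x = 0) (x : ι) (hx : ¬ k < b x) :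
    (u ᵥ* A) x = 0 := by
  refine sum_eq_zero fun y _ => ?_
  dsimp only
  by_cases h : b x < b y
  · rw [hA h, mul_zero]
  · rw [hu y (fun h' => hx (h'.trans_le (not_lt.1 h))), zero_mul]

/-- A finite family of arcs between nodes of a linear order, with nonzero coefficients, together with
a distinguished arc `top x` among the arcs that start where `x` starts and a distinguished arc `bot x`
among the arcs that end where `x` ends. -/
structure ArcSystem (ι κ F : Type*) [Fintype ι] [DecidableEq ι] [LinearOrder κ] [Field F] where
  src : ι → κ
  tgt : ι → κ
  src_lt_tgt : ∀ x, src x < tgt x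
  coeff : ι → F
  coeff_ne_zero : ∀ x, coeff x ≠ 0
  top : ι → ι
  bot : ι → ι
  src_top : ∀ x, src (top x) = src x
  tgt_le_tgt_top : ∀ x, tgt x ≤ tgt (top x)
  top_congr : ∀ x y, src x = src y → top x = top y
  tgt_bot : ∀ x, tgt (bot x) = tgt x
  src_bot_le_src : ∀ x, src (bot x) ≤ src x
  bot_congr : ∀ x y, tgt x = tgt y → bot x = bot y
  -- The two weight conditions encode the interchange of left ends: the first makes the basis change
  -- invertible, the second makes the image of a source vector vanish at a bottom arc parallel to,
  -- but different from, the top arc.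
  weight_ne_zero : ∀ x, top x = x → bot x = x →
    ∑ z with src z = src x ∧ tgt z = tgt x, coeff z ≠ 0
  weight_eq_zero : ∀ x y, top x = x → bot y = y → src x = src y → tgt x = tgt y → x ≠ y →
    ∑ z with src z = src x ∧ tgt z = tgt x, coeff z = 0

namespace ArcSystem

variable {ι κ F : Type*} [Fintype ι] [DecidableEq ι] [LinearOrder κ] [Field F]
variable (S : ArcSystem ι κ F)

/-- The rows of `P` and `Q` are unitriangular with respect to the left and right endpoints, and the
product of `P`, the diagonal matrix of coefficients and the transpose of `Q` vanishes above the diagonal. -/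
structure IsSolution (P Q : κ → ι → F) : Prop where
  left : ∀ j x, ¬ S.src x < j → P j x = if S.src x = j then 1 else 0
  right : ∀ k x, ¬ k < S.tgt x → Q k x = if S.tgt x = k then 1 else 0
  orth : ∀ j k, j < k → ∑ x, S.coeff x * P j x * Q k x = 0

theorem top_top (x : ι) : S.top (S.top x) = S.top x := S.top_congr _ _ (S.src_top x)

theorem bot_bot (x : ι) : S.bot (S.bot x) = S.bot x := S.bot_congr _ _ (S.tgt_bot x)

/-- The linear form that is the coordinate of `x` in the adapted basis. -/
def coordForm (x : ι) : (ι → F) →ₗ[F] F :=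
  -- At a bottom arc the row must be the weighted sum over the arcs ending there, up to arcs ending
  -- later, so that target vectors become unit vectors. Subtracting coordinates of top arcs removes
  -- the rest of the source vectors.
  if S.bot x = x then
    ∑ z with S.tgt z = S.tgt x, S.coeff z • ((LinearMap.proj z : (ι → F) →ₗ[F] F) -
      if S.tgt z < S.tgt (S.top z) then (LinearMap.proj (S.top z) : (ι → F) →ₗ[F] F) else 0)
  else (LinearMap.proj x : (ι → F) →ₗ[F] F) - if S.top x = x then 0 else (LinearMap.proj (S.top x) : (ι → F) →ₗ[F] F)

/-- The matrix of the change to the adapted basis. -/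
def basisChange : Matrix ι ι F := LinearMap.toMatrix' (LinearMap.pi S.coordForm)

theorem basisChange_mulVec (v : ι → F) (x : ι) : (S.basisChange *ᵥ v) x = S.coordForm x v := by
  rw [basisChange, LinearMap.toMatrix'_mulVec, LinearMap.pi_apply]

theorem coordForm_of_bot {x : ι} (hx : S.bot x = x) (v : ι → F) :
    S.coordForm x v = ∑ z with S.tgt z = S.tgt x, S.coeff z * (v z -
      if S.tgt z < S.tgt (S.top z) then v (S.top z) else 0) := by
  rw [coordForm, if_pos hx, LinearMap.sum_apply]
  refine sum_congr rfl fun z _ => ?_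
  split_ifs <;> simp

theorem coordForm_of_not_bot {x : ι} (hx : S.bot x ≠ x) (v : ι → F) :
    S.coordForm x v = v x - if S.top x = x then 0 else v (S.top x) := by
  rw [coordForm, if_neg hx]
  split_ifs <;> simp

theorem basisChange_apply (x y : ι) : S.basisChange x y = S.coordForm x (Pi.single y 1) := by
  rw [← basisChange_mulVec]; simp

/-- The form at a bottom arc involves arcs with the same right end, which start no earlier, and
their top arcs, which share their starts. For right ends the analogous reason is that top arcs reach
at least as far. -/
theorem basisChange_blockTriangular_src : S.basisChange.BlockTriangular S.src := by
  intro x y hxy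
  have hne : ∀ z, S.src x ≤ S.src z → (Pi.single y (1 : F) : ι → F) z = 0 := fun z hz =>
    Pi.single_eq_of_ne (by rintro rfl; exact absurd hxy (not_lt.2 hz)) _
  rw [basisChange_apply]
  by_cases hx : S.bot x = x
  · rw [S.coordForm_of_bot hx]
    refine sum_eq_zero fun z hz => ?_
    have h : S.src x ≤ S.src z := by
      rw [← hx, S.bot_congr x z (mem_filter.1 hz).2.symm]; exact S.src_bot_le_src z
    rw [hne z h, hne (S.top z) (by rwa [S.src_top])]; simp
  · rw [S.coordForm_of_not_bot hx, hne x le_rfl, hne (S.top x) (S.src_top x).ge]; simp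

theorem basisChange_blockTriangular_tgt : S.basisChange.BlockTriangular S.tgt := by
  intro x y hxy
  have hne : ∀ z, S.tgt x ≤ S.tgt z → (Pi.single y (1 : F) : ι → F) z = 0 := fun z hz =>
    Pi.single_eq_of_ne (by rintro rfl; exact absurd hxy (not_lt.2 hz)) _
  rw [basisChange_apply]
  by_cases hx : S.bot x = x
  · rw [S.coordForm_of_bot hx]
    refine sum_eq_zero fun z hz => ?_
    have h : S.tgt x ≤ S.tgt z := (mem_filter.1 hz).2.ge
    rw [hne z h, hne (S.top z) (h.trans (S.tgt_le_tgt_top z))]; simp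
  · rw [S.coordForm_of_not_bot hx, hne x le_rfl, hne (S.top x) (S.tgt_le_tgt_top x)]; simp

/-- Off the bottom arcs, every coordinate equals that of the top arc or is zero. At an arc that is
both top and bottom, the form therefore collapses to the weight of its class times the coordinate,
and that weight is nonzero; the other coordinates follow. -/
theorem eq_zero_of_coordForm_eq_zero {v : ι → F} (hv : ∀ x, S.coordForm x v = 0) : v = 0 := by
  have h1 : ∀ x, S.bot x ≠ x → v x = if S.top x = x then 0 else v (S.top x) := fun x hx => by
    have := hv x
    rw [S.coordForm_of_not_bot hx] at this
    exact sub_eq_zero.1 this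
  have h2 : ∀ x, S.bot x = x → S.top x = x → v x = 0 := fun x hb ht => by
    have := hv x
    rw [S.coordForm_of_bot hb, ← sum_subset (s₁ := univ.filter fun z => S.src z = S.src x ∧ S.tgt z = S.tgt x)
      (fun z hz => by simp at hz ⊢; exact hz.2)] at this
    · rw [sum_congr rfl (g := fun z => S.coeff z * v x), ← sum_mul] at this
      · exact (mul_eq_zero.1 this).resolve_left (S.weight_ne_zero x ht hb)
      · intro z hz
        obtain ⟨hs, hz⟩ := (mem_filter.1 hz).2
        have htop : S.top z = x := (S.top_congr _ _ hs).trans ht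
        rw [htop, hz, if_neg (lt_irrefl _), sub_zero]
        by_cases hzx : z = x
        · rw [hzx]
        · rw [h1 z (by rw [S.bot_congr _ _ hz, hb]; exact Ne.symm hzx), htop, if_neg (Ne.symm hzx)]
    -- An arc ending at the same node but starting elsewhere contributes nothing: if its top arc
    -- reaches farther, the two coordinates cancel; otherwise its top arc is not a bottom arc, so
    -- both coordinates vanish.
    · intro z hz hz'
      have hz : S.tgt z = S.tgt x := by simpa using hz
      have hs : S.src z ≠ S.src x := fun h => hz' (by simp [h, hz])
      have hzx : z ≠ x := fun h => hs (by rw [h])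
      rw [h1 z (by rw [S.bot_congr _ _ hz, hb]; exact Ne.symm hzx)]
      rcases (S.tgt_le_tgt_top z).lt_or_eq with h | h
      · rw [if_pos h, if_neg (by intro h'; rw [h'] at h; exact lt_irrefl _ h)]; simp
      · rw [if_neg h.not_lt]
        split_ifs with h'
        · simp
        · rw [h1 (S.top z), if_pos (S.top_top z)]
          · simp
          · rw [S.bot_congr (S.top z) x (by rw [← h, hz]), hb]
            intro h''; exact hs (by rw [h'', S.src_top])
  have h3 : ∀ x, S.top x = x → v x = 0 := fun x ht => by
    by_cases hb : S.bot x = x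
    · exact h2 x hb ht
    · rw [h1 x hb, if_pos ht]
  have h4 : ∀ x, S.bot x ≠ x → v x = 0 := fun x hb => by
    rw [h1 x hb]; split_ifs
    · rfl
    · exact h3 _ (S.top_top x)
  funext x
  by_cases hb : S.bot x = x
  · have := hv x
    rw [S.coordForm_of_bot hb, sum_eq_single x] at this
    · rw [h3 _ (S.top_top x)] at this
      simpa [S.coeff_ne_zero x] using this
    · intro z hz hzx
      rw [h3 _ (S.top_top z), h4 z (by rw [S.bot_congr _ _ (mem_filter.1 hz).2, hb]; exact Ne.symm hzx)]
      simp
    · simp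
  · exact h4 x hb

theorem isUnit_basisChange : IsUnit S.basisChange := by
  rw [← Matrix.mulVec_injective_iff_isUnit]
  have : Function.Injective S.basisChange.mulVecLin := by
    rw [injective_iff_map_eq_zero]
    intro v hv
    refine S.eq_zero_of_coordForm_eq_zero fun x => ?_
    rw [← basisChange_mulVec]
    exact congrFun hv x
  exact this

/-- The value of the form that is the coordinate of `x = top x` on the sum of all arcs starting at
the same node. -/
def scale (x : ι) : F :=
  if S.bot x = x then ∑ z with S.src z = S.src x ∧ S.tgt z = S.tgt x, S.coeff z else 1

theorem scale_ne_zero {x : ι} (hx : S.top x = x) : S.scale x ≠ 0 := by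
  unfold scale
  split_ifs with h
  · exact S.weight_ne_zero x hx h
  · exact one_ne_zero

/-- Modulo arcs starting before `j`, the source vector becomes a multiple of one basis vector. The
delicate coordinate is at a bottom arc: its value is the weight of its class if the top arc is
parallel to it, and zero otherwise. -/
theorem basisChange_mulVec_source (j : κ) (x : ι) (hx : ¬ S.src x < j) :
    (S.basisChange *ᵥ fun y => if S.src y = j then 1 else 0) x =
      if S.src x = j ∧ S.top x = x then S.scale x else 0 := by
  rw [basisChange_mulVec]
  by_cases hb : S.bot x = x
  · rw [S.coordForm_of_bot hb]
    simp only [S.src_top]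
    have hsum : ∑ z with S.tgt z = S.tgt x, S.coeff z * ((if S.src z = j then (1 : F) else 0) -
        if S.tgt z < S.tgt (S.top z) then (if S.src z = j then 1 else 0) else 0) =
        ∑ z with S.tgt z = S.tgt x, if S.src z = j ∧ S.tgt (S.top z) = S.tgt x then S.coeff z else 0 := by
      refine sum_congr rfl fun z hz => ?_
      have hz := (mem_filter.1 hz).2
      have := S.tgt_le_tgt_top z
      rw [← hz]
      rcases this.lt_or_eq with h | h
      · simp [h, h.ne']
      · rw [if_neg h.not_lt]
        by_cases hj : S.src z = j <;> simp [hj, h.symm]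
    rw [hsum, ← sum_filter, filter_filter]
    by_cases hsx : S.src x = j
    · by_cases htop : S.tgt (S.top x) = S.tgt x
      · have hf : (univ.filter fun z => S.tgt z = S.tgt x ∧ S.src z = j ∧ S.tgt (S.top z) = S.tgt x) =
            univ.filter fun z => S.src z = S.src x ∧ S.tgt z = S.tgt x := by
          ext z
          simp only [mem_filter, mem_univ, true_and, hsx]
          constructor
          · tauto
          · rintro ⟨h1, h2⟩
            exact ⟨h2, h1, by rw [S.top_congr z x (h1.trans hsx.symm), htop]⟩
        rw [hf]
        by_cases ht : S.top x = x
        · rw [if_pos ⟨hsx, ht⟩, scale, if_pos hb]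
        · rw [if_neg (fun h => ht h.2)]
          -- Top and bottom arcs of this class differ, so its weight is zero.
          have := S.weight_eq_zero (S.top x) x (S.top_top x) hb (S.src_top x) htop ht
          rwa [S.src_top, htop] at this
      · rw [if_neg (fun h => htop (by rw [h.2]))]
        refine sum_eq_zero fun z hz => ?_
        obtain ⟨-, h1, h2⟩ := (mem_filter.1 hz).2
        rw [S.top_congr z x (h1.trans hsx.symm)] at h2
        exact absurd h2 htop
    · rw [if_neg (fun h => hsx h.1)]
      refine sum_eq_zero fun z hz => ?_
      obtain ⟨h0, h1, h2⟩ := (mem_filter.1 hz).2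
      have hle : S.src x ≤ S.src z := by
        rw [← hb, ← S.bot_congr z x h0]; exact S.src_bot_le_src z
      exact absurd (lt_of_le_of_ne (h1 ▸ hle) hsx) hx
  · rw [S.coordForm_of_not_bot hb, scale, if_neg hb, S.src_top]
    by_cases ht : S.top x = x <;> by_cases hs : S.src x = j <;> simp [ht, hs]

theorem vecMul_basisChange_target (k : κ) (x : ι) (hx : ¬ k < S.tgt x) :
    ((fun y => if S.tgt y = k ∧ S.bot y = y then 1 else 0) ᵥ* S.basisChange) x =
      if S.tgt x = k then S.coeff x else 0 := by
  simp only [Matrix.vecMul, dotProduct, ite_mul, one_mul, zero_mul]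
  by_cases h : ∃ y, S.tgt y = k
  · obtain ⟨y, hy⟩ := h
    rw [sum_eq_single (S.bot y), if_pos ⟨by rw [S.tgt_bot, hy], S.bot_bot y⟩, basisChange_apply,
      S.coordForm_of_bot (S.bot_bot y), S.tgt_bot, hy]
    · have h0 : ∀ z ∈ univ.filter (fun z => S.tgt z = k), S.coeff z * ((Pi.single x (1 : F) : ι → F) z -
          if S.tgt z < S.tgt (S.top z) then (Pi.single x (1 : F) : ι → F) (S.top z) else 0) =
          if x = z then S.coeff z else 0 := by
        intro z hz
        have hz : S.tgt z = k := (mem_filter.1 hz).2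
        have : (if S.tgt z < S.tgt (S.top z) then (Pi.single x (1 : F) : ι → F) (S.top z) else 0) = 0 := by
          split_ifs with h
          · exact Pi.single_eq_of_ne (by rintro rfl; exact hx (hz ▸ h)) _
          · rfl
        rw [this, sub_zero, Pi.single_apply]
        simp [eq_comm]
      rw [sum_congr rfl h0, sum_ite_eq]
      simp
    · intro z _ hz
      rw [if_neg]
      rintro ⟨h1, h2⟩
      exact hz (by rw [← h2, S.bot_congr z y (h1.trans hy.symm)])
    · simp
  · rw [if_neg fun h' => h ⟨x, h'⟩]
    exact sum_eq_zero fun y _ => if_neg fun h' => h ⟨y, h'.1⟩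

/-- The version of `IsSolution` in the adapted basis. -/
structure IsReducedSolution (P Q : κ → ι → F) : Prop where
  left : ∀ j x, ¬ S.src x < j → P j x = if S.src x = j ∧ S.top x = x then S.scale x else 0
  right : ∀ k x, ¬ k < S.tgt x → Q k x = if S.tgt x = k ∧ S.bot x = x then 1 else 0
  orth : ∀ j k, j < k → Q k ⬝ᵥ P j = 0

/-- With B the basis change, P_j is replaced by B P_j and the row of products `coeff x * Q k x` by
its product with B⁻¹, which preserves the pairing. The two triangularities of B and B⁻¹ preserve the
spaces of free coordinates, so only the prescribed vectors need to be computed. -/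
theorem exists_isSolution_iff_exists_isReducedSolution :
    (∃ P Q, S.IsSolution P Q) ↔ ∃ P Q, S.IsReducedSolution P Q := by
  obtain ⟨u, hu⟩ := S.isUnit_basisChange
  have inst : Invertible S.basisChange := hu ▸ u.invertible
  have hmul : S.basisChange * S.basisChange⁻¹ = 1 := Matrix.mul_inv_of_invertible _
  have hmul' : S.basisChange⁻¹ * S.basisChange = 1 := Matrix.inv_mul_of_invertible _
  have hs := S.basisChange_blockTriangular_src
  have ht := S.basisChange_blockTriangular_tgt
  have hs' := Matrix.blockTriangular_inv_of_blockTriangular hs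
  have ht' := Matrix.blockTriangular_inv_of_blockTriangular ht
  constructor
  · rintro ⟨P, Q, h⟩
    refine ⟨fun j => S.basisChange *ᵥ P j, fun k => (fun x => S.coeff x * Q k x) ᵥ* S.basisChange⁻¹,
      ⟨fun j x hx => ?_, fun k x hx => ?_, fun j k hjk => ?_⟩⟩
    · rw [← S.basisChange_mulVec_source j x hx, ← sub_eq_zero, ← Pi.sub_apply, ← Matrix.mulVec_sub]
      refine mulVec_eq_zero_of_blockTriangular hs (fun y hy => ?_) x hx
      rw [Pi.sub_apply, h.left j y hy, sub_self]
    · have h1 : (fun y => if S.tgt y = k ∧ S.bot y = y then (1 : F) else 0) =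
          ((fun y => if S.tgt y = k ∧ S.bot y = y then (1 : F) else 0) ᵥ* S.basisChange) ᵥ*
            S.basisChange⁻¹ := by
        rw [Matrix.vecMul_vecMul, hmul, Matrix.vecMul_one]
      have h2 := congrFun h1 x
      rw [h2, ← sub_eq_zero, ← Pi.sub_apply, ← Matrix.sub_vecMul]
      refine vecMul_eq_zero_of_blockTriangular ht' (fun y hy => ?_) x hx
      rw [Pi.sub_apply, S.vecMul_basisChange_target k y hy, h.right k y hy]
      split_ifs <;> simp
    · rw [Matrix.dotProduct_mulVec, Matrix.vecMul_vecMul, hmul', Matrix.vecMul_one]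
      rw [← h.orth j k hjk]
      exact sum_congr rfl fun x _ => by ring
  · rintro ⟨P, Q, h⟩
    refine ⟨fun j => S.basisChange⁻¹ *ᵥ P j, fun k x => (S.coeff x)⁻¹ * (Q k ᵥ* S.basisChange) x,
      ⟨fun j x hx => ?_, fun k x hx => ?_, fun j k hjk => ?_⟩⟩
    · have h1 : (fun y => if S.src y = j then (1 : F) else 0) =
          S.basisChange⁻¹ *ᵥ (S.basisChange *ᵥ fun y => if S.src y = j then (1 : F) else 0) := by
        rw [Matrix.mulVec_mulVec, hmul', Matrix.one_mulVec]
      have h2 := congrFun h1 x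
      rw [h2, ← sub_eq_zero, ← Pi.sub_apply, ← Matrix.mulVec_sub]
      refine mulVec_eq_zero_of_blockTriangular hs' (fun y hy => ?_) x hx
      rw [Pi.sub_apply, h.left j y hy, S.basisChange_mulVec_source j y hy, sub_self]
    · have h1 : (Q k ᵥ* S.basisChange) x = if S.tgt x = k then S.coeff x else 0 := by
        rw [← S.vecMul_basisChange_target k x hx, ← sub_eq_zero, ← Pi.sub_apply, ← Matrix.sub_vecMul]
        refine vecMul_eq_zero_of_blockTriangular ht (fun y hy => ?_) x hx
        rw [Pi.sub_apply, h.right k y hy, sub_self]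
      rw [h1]
      have := S.coeff_ne_zero x
      split_ifs <;> simp [this]
    · rw [← h.orth j k hjk]
      have : Q k ⬝ᵥ P j = (Q k ᵥ* S.basisChange) ⬝ᵥ (S.basisChange⁻¹ *ᵥ P j) := by
        rw [Matrix.dotProduct_mulVec, Matrix.vecMul_vecMul, hmul, Matrix.vecMul_one]
      rw [this]
      refine sum_congr rfl fun x _ => ?_
      have := S.coeff_ne_zero x
      field_simp

/-! ### Solvability of the reduced system and Hall's condition. -/

/-- An arc distinguished at both ends. -/
abbrev Filled : Type _ := {x // S.top x = x ∧ S.bot x = x}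

/-- An arc distinguished at neither end. -/
abbrev Hollow : Type _ := {x // S.top x ≠ x ∧ S.bot x ≠ x}

/-- `y` is strictly nested in `x`. -/
abbrev Inside (y x : ι) : Prop := S.src x < S.src y ∧ S.tgt y < S.tgt x

/-- For each filled `y`, add `scale y` at `f y` to P at `src y`, and subtract 1 at `f y` from Q at
`tgt y`. Nesting makes these coordinates free. As `f y` is hollow and `f` is injective, the
corrections meet only each other, and their product cancels the pairing at `y`. -/
theorem exists_isReducedSolution_of_injective (f : S.Filled → S.Hollow) (hf : Function.Injective f)
    (hin : ∀ y, S.Inside y.1 (f y).1) : ∃ P Q, S.IsReducedSolution P Q := by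
  have hs : ∀ y : S.Filled, ∀ x : ι, (f y).1 = x → S.src x < S.src y.1 := by
    rintro y x rfl; exact (hin y).1
  have ht : ∀ y : S.Filled, ∀ x : ι, (f y).1 = x → S.tgt y.1 < S.tgt x := by
    rintro y x rfl; exact (hin y).2
  refine ⟨fun j x => (if S.src x = j ∧ S.top x = x then S.scale x else 0) +
      ∑ y : S.Filled, if S.src y.1 = j ∧ (f y).1 = x then S.scale y.1 else 0,
    fun k x => (if S.tgt x = k ∧ S.bot x = x then 1 else 0) -
      ∑ y : S.Filled, if S.tgt y.1 = k ∧ (f y).1 = x then 1 else 0,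
    ⟨fun j x hx => ?_, fun k x hx => ?_, fun j k hjk => ?_⟩⟩
  · rw [add_eq_left]
    refine sum_eq_zero fun y _ => if_neg ?_
    rintro ⟨rfl, h⟩
    exact hx (hs y x h)
  · rw [sub_eq_self]
    refine sum_eq_zero fun y _ => if_neg ?_
    rintro ⟨rfl, h⟩
    exact hx (ht y x h)
  · have e1 : ∀ x, ((if S.tgt x = k ∧ S.bot x = x then (1 : F) else 0) -
        ∑ y : S.Filled, if S.tgt y.1 = k ∧ (f y).1 = x then 1 else 0) *
        ((if S.src x = j ∧ S.top x = x then S.scale x else 0) +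
          ∑ y : S.Filled, if S.src y.1 = j ∧ (f y).1 = x then S.scale y.1 else 0) =
        (∑ y : S.Filled, if y.1 = x then
          (if S.src y.1 = j ∧ S.tgt y.1 = k then S.scale y.1 else 0) else 0) -
        ∑ y : S.Filled, if (f y).1 = x then
          (if S.src y.1 = j ∧ S.tgt y.1 = k then S.scale y.1 else 0) else 0 := by
      intro x
      by_cases hfx : ∃ y, (f y).1 = x
      · obtain ⟨y, rfl⟩ := hfx
        have h1 : ∀ z : S.Filled, z.1 ≠ (f y).1 := fun z h => (f y).2.1 (h ▸ z.2.1)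
        have h2 : ∀ z, (f z).1 = (f y).1 ↔ z = y := fun z =>
          ⟨fun h => hf (Subtype.ext h), fun h => by rw [h]⟩
        simp only [(f y).2.1, (f y).2.2, and_false, if_false, h1, h2, sum_const_zero, ite_and]
        simp only [sum_ite, sum_const_zero, add_zero, filter_filter]
        by_cases hj : S.src y.1 = j <;> by_cases hk : S.tgt y.1 = k <;>
          simp [filter_and, filter_eq', hj, hk]
      · push Not at hfx
        simp only [hfx, and_false, if_false, sum_const_zero, sub_zero, add_zero]
        by_cases hx : S.top x = x ∧ S.bot x = x
        · rw [sum_eq_single (⟨x, hx⟩ : S.Filled)]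
          · simp only [hx.1, hx.2, and_true, if_true]
            by_cases hj : S.src x = j <;> by_cases hk : S.tgt x = k <;> simp [hj, hk]
          · intro y _ hy
            exact if_neg fun h => hy (Subtype.ext h)
          · simp
        · rw [sum_eq_zero fun y _ => if_neg fun h : y.1 = x => hx (h ▸ y.2)]
          by_cases h1 : S.top x = x
          · have h2 : S.bot x ≠ x := fun h => hx ⟨h1, h⟩
            simp [h2]
          · simp [h1]
    rw [dotProduct, sum_congr rfl fun x _ => e1 x, sum_sub_distrib, sub_eq_zero, sum_comm]
    conv_rhs => rw [sum_comm]
    simp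

/-- A violation of Hall's condition leaves fewer equations than unknowns for a combination p ≠ 0 of
the P_j that vanishes at top arcs outside `Y` and at hollow arcs around `Y`. Let `y` be the top arc
at the last node used: p is nonzero there, so `y` is in `Y`, and p ⟂ Q_k for all k > `src y`. Among
the arcs of the support ending last there can be no bottom arc, as Q at that node would detect it.
Such an arc is then hollow and encloses `y`, where p was made to vanish. -/
theorem card_le_card_hollow_of_isReducedSolution {P Q : κ → ι → F} (h : S.IsReducedSolution P Q)
    (Y : Finset S.Filled) :
    #Y ≤ #(Y.biUnion fun y => univ.filter fun x : S.Hollow => S.Inside y.1 x.1) := by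
  classical
  by_contra hlt
  rw [not_le] at hlt
  set N := Y.biUnion fun y => univ.filter fun x : S.Hollow => S.Inside y.1 x.1 with hN
  set Y' : Finset ι := Y.map (Function.Embedding.subtype _) with hY'
  set N' : Finset ι := N.map (Function.Embedding.subtype _) with hN'
  set L : Finset ι := univ.filter fun x => S.top x = x with hL
  have hYL : Y' ⊆ L := by
    intro x hx
    obtain ⟨y, -, rfl⟩ := Finset.mem_map.1 hx
    simpa [hL] using y.2.1
  -- `L` has one arc for each node where arcs start, hence indexes the unknowns; `C` indexes the
  -- equations.
  set C : Finset ι := (L \ Y') ∪ N' with hC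
  have hcard : #C < #L := by
    have h1 : #C ≤ #(L \ Y') + #N' := card_union_le _ _
    have h2 : #(L \ Y') + #Y' = #L := card_sdiff_add_card_eq_card hYL
    have h3 : #Y' = #Y := card_map _
    have h4 : #N' = #N := card_map _
    omega
  let φ : (L → F) →ₗ[F] (C → F) :=
    LinearMap.pi fun x => ∑ a : L, P (S.src a.1) x.1 • LinearMap.proj a
  have hφ : ∀ c x, φ c x = ∑ a : L, P (S.src a.1) x.1 * c a := fun c x => by
    simp [φ, LinearMap.sum_apply]
  obtain ⟨c, hc, hc0⟩ := Submodule.exists_mem_ne_zero_of_ne_bot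
    (LinearMap.ker_ne_bot_of_finrank_lt (f := φ) (by simpa using hcard))
  set p : ι → F := fun x => ∑ a : L, P (S.src a.1) x * c a with hp
  have hpC : ∀ x ∈ C, p x = 0 := fun x hx => by
    have := congrFun (LinearMap.mem_ker.1 hc) ⟨x, hx⟩
    rwa [hφ] at this
  obtain ⟨a₀, ha₀⟩ := Function.ne_iff.1 hc0
  obtain ⟨y, hy, hmax⟩ := exists_max_image (univ.filter fun a : L => c a ≠ 0) (fun a => S.src a.1)
    ⟨a₀, by simpa using ha₀⟩
  have hcy : c y ≠ 0 := (mem_filter.1 hy).2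
  have hmax : ∀ a, c a ≠ 0 → S.src a.1 ≤ S.src y.1 := fun a ha => hmax a (by simpa using ha)
  have hty : S.top y.1 = y.1 := (mem_filter.1 y.2).2
  have hinj : ∀ a : L, S.src a.1 = S.src y.1 → a = y := fun a ha => Subtype.ext <| by
    rw [← hty, ← S.top_congr _ _ ha, (mem_filter.1 a.2).2]
  -- the support of `p` and its value at `y`
  have hpy : p y.1 ≠ 0 := by
    rw [hp]
    dsimp only
    rw [sum_eq_single y, h.left _ _ (lt_irrefl _), if_pos ⟨rfl, hty⟩]
    · exact mul_ne_zero (S.scale_ne_zero hty) hcy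
    · intro a _ ha
      by_cases hca : c a = 0
      · rw [hca, mul_zero]
      · have hne : S.src a.1 ≠ S.src y.1 := fun h => ha (hinj a h)
        have := lt_of_le_of_ne (hmax a hca) hne
        rw [h.left _ _ this.not_gt, if_neg fun h => hne h.1.symm, zero_mul]
    · simp
  have hsupp : ∀ x, p x ≠ 0 → S.top x ≠ x → S.src x < S.src y.1 := by
    intro x hx htx
    by_contra hlt'
    refine hx (sum_eq_zero fun a _ => ?_)
    by_cases hca : c a = 0
    · rw [hca, mul_zero]
    · rw [h.left _ _ fun h' => hlt' (h'.trans_le (hmax a hca)), if_neg fun h => htx h.2, zero_mul]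
  have horth : ∀ k, S.src y.1 < k → Q k ⬝ᵥ p = 0 := by
    intro k hk
    have : Q k ⬝ᵥ p = ∑ a : L, (Q k ⬝ᵥ P (S.src a.1)) * c a := by
      simp only [hp, dotProduct, mul_sum, sum_mul]
      rw [sum_comm]
      simp only [mul_assoc]
    rw [this]
    refine sum_eq_zero fun a _ => ?_
    by_cases hca : c a = 0
    · rw [hca, mul_zero]
    · rw [h.orth _ _ ((hmax a hca).trans_lt hk), zero_mul]
  have hmemY : ∀ x, p x ≠ 0 → S.top x = x → x ∈ Y' := by
    intro x hx ht
    by_contra hxY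
    exact hx (hpC x (by simp [hC, hL, ht, hxY]))
  have hbot : ∀ x ∈ Y', S.bot x = x := by
    intro x hx
    obtain ⟨y, -, rfl⟩ := Finset.mem_map.1 hx
    exact y.2.2
  have hyY := hmemY _ hpy hty
  obtain ⟨z, hz, hzmax⟩ := exists_max_image (univ.filter fun x => p x ≠ 0) S.tgt
    ⟨y.1, by simpa using hpy⟩
  have hpz : p z ≠ 0 := (mem_filter.1 hz).2
  have hzmax : ∀ x, p x ≠ 0 → S.tgt x ≤ S.tgt z := fun x hx => hzmax x (by simpa using hx)
  -- no arc in the support with maximal right endpoint is distinguished at that endpoint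
  have key : ∀ x, p x ≠ 0 → S.tgt x = S.tgt z → S.bot x ≠ x := by
    intro x hx hxz hbx
    have := horth (S.tgt z) ((S.src_lt_tgt _).trans_le (hzmax _ hpy))
    rw [dotProduct, sum_eq_single x, h.right _ _ (by rw [hxz]; exact lt_irrefl _),
      if_pos ⟨hxz, hbx⟩, one_mul] at this
    · exact hx this
    · intro w _ hwx
      by_cases hw : p w = 0
      · rw [hw, mul_zero]
      · rw [h.right _ _ (hzmax w hw).not_gt, if_neg, zero_mul]
        rintro ⟨h1, h2⟩
        exact hwx (by rw [← h2, S.bot_congr w x (h1.trans hxz.symm), hbx])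
    · simp
  have hbz := key z hpz rfl
  have htz : S.top z ≠ z := fun ht => hbz (hbot z (hmemY z hpz ht))
  have hlt1 := hsupp z hpz htz
  have hlt2 : S.tgt y.1 < S.tgt z := lt_of_le_of_ne (hzmax _ hpy) fun heq =>
    key y.1 hpy heq (hbot _ hyY)
  refine hpz (hpC z (mem_union_right _ ?_))
  obtain ⟨y', hy', hyy'⟩ := Finset.mem_map.1 hyY
  refine Finset.mem_map.2 ⟨⟨z, htz, hbz⟩, mem_biUnion.2 ⟨y', hy', ?_⟩, rfl⟩
  have hyy' : y'.1 = y.1 := hyy'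
  simpa [hyy'] using ⟨hlt1, hlt2⟩

/-- The bilinear system of an arc system is solvable exactly when the filled arcs can be matched into
hollow arcs around them. -/
theorem exists_isSolution_iff : (∃ P Q, S.IsSolution P Q) ↔
    ∃ f : S.Filled → S.Hollow, Function.Injective f ∧ ∀ y, S.Inside y.1 (f y).1 := by
  rw [exists_isSolution_iff_exists_isReducedSolution]
  constructor
  · rintro ⟨P, Q, h⟩
    obtain ⟨f, hf, hfm⟩ := (Finset.all_card_le_biUnion_card_iff_exists_injective _).1
      (S.card_le_card_hollow_of_isReducedSolution h)
    exact ⟨f, hf, fun y => by simpa using hfm y⟩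
  · rintro ⟨f, hf, hin⟩
    exact S.exists_isReducedSolution_of_injective f hf hin

end ArcSystem

/-! ### Heights of stacked endpoints. -/

namespace UnitriSuper

theorem prod_map_coe_list {A : Type*} [CommMonoid A] {B : Type*} (D : List B) (f : B → A) :
    ((D : Multiset B).map f).prod = ∏ x : Fin D.length, f (D.get x) := by
  rw [Multiset.map_coe, Multiset.prod_coe, ← List.prod_ofFn]
  congr 1
  conv_lhs => rw [← List.ofFn_get D, List.map_ofFn]
  rfl

theorem sum_map_coe_list {A : Type*} [AddCommMonoid A] {B : Type*} (D : List B) (f : B → A) :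
    ((D : Multiset B).map f).sum = ∑ x : Fin D.length, f (D.get x) := by
  rw [Multiset.map_coe, Multiset.sum_coe, ← List.sum_ofFn]
  congr 1
  conv_lhs => rw [← List.ofFn_get D, List.map_ofFn]
  rfl

theorem sum_map_filter {A B : Type*} [AddCommMonoid A] (p : B → Prop) [DecidablePred p] (f : B → A)
    (s : Multiset B) : ((s.filter p).map f).sum = (s.map fun b => if p b then f b else 0).sum := by
  induction s using Multiset.induction_on with
  | empty => simp
  | cons b s ih => by_cases h : p b <;> simp [h, ih]

variable {F : Type*} [Field F]

theorem wt_coe_list (D : List (Arc F)) (j k : ℕ+) :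
    wt (D : Multiset (Arc F)) j k =
      ∑ x : Fin D.length with (D.get x).src = j ∧ (D.get x).tgt = k, ((D.get x).label : F) := by
  rw [wt, sum_map_filter, sum_map_coe_list, sum_filter]

theorem Parallel.symm {D : List (Arc F)} {x y : Fin D.length} (h : Parallel D x y) : Parallel D y x :=
  ⟨h.1.symm, h.2.symm⟩

theorem Parallel.trans {D : List (Arc F)} {x y z : Fin D.length} (h : Parallel D x y)
    (h' : Parallel D y z) : Parallel D x z := ⟨h.1.trans h'.1, h.2.trans h'.2⟩

theorem mult_congr {D : List (Arc F)} {x y : Fin D.length} (h : Parallel D x y) :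
    mult D x = mult D y := by
  unfold mult
  congr 1
  ext z
  simp only [mem_filter, mem_univ, true_and]
  exact ⟨fun h' => h'.trans h, fun h' => h'.trans h.symm⟩

theorem pos_lt_pos {D : List (Arc F)} {x y : Fin D.length} (h : Parallel D x y) (hxy : x < y) :
    pos D x < pos D y := by
  refine card_lt_card ⟨fun z hz => ?_, fun hsub => ?_⟩
  · simp only [mem_filter, mem_univ, true_and] at hz ⊢
    exact ⟨hz.1.trans h, hz.2.trans hxy.le⟩
  · have hy : Parallel D y y := ⟨rfl, rfl⟩
    have := @hsub y (by simp [hy])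
    simp only [mem_filter, mem_univ, true_and] at this
    exact absurd hxy (not_lt.2 this.2)

theorem eq_of_pos_eq {D : List (Arc F)} {x y : Fin D.length} (h : Parallel D x y)
    (hp : pos D x = pos D y) : x = y := by
  rcases lt_trichotomy x y with hxy | hxy | hxy
  · exact absurd hp (pos_lt_pos h hxy).ne
  · exact hxy
  · exact absurd hp (pos_lt_pos h.symm hxy).ne'

theorem pos_le_mult (D : List (Arc F)) (x : Fin D.length) : pos D x ≤ mult D x :=
  card_le_card fun z hz => by
    simp only [mem_filter, mem_univ, true_and] at hz ⊢
    exact hz.1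

theorem one_le_pos (D : List (Arc F)) (x : Fin D.length) : 1 ≤ pos D x :=
  by
  have hx : Parallel D x x := ⟨rfl, rfl⟩
  exact card_pos.2 ⟨x, by simp [hx]⟩

theorem exists_pos_eq {D : List (Arc F)} (x : Fin D.length) {n : ℕ} (h1 : 1 ≤ n) (h2 : n ≤ mult D x) :
    ∃ y, Parallel D y x ∧ pos D y = n := by
  classical
  have hsub : (univ.filter fun y => Parallel D y x).image (pos D) ⊆ Icc 1 (mult D x) := by
    intro m hm
    obtain ⟨y, hy, rfl⟩ := mem_image.1 hm
    have hy : Parallel D y x := (mem_filter.1 hy).2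
    exact mem_Icc.2 ⟨one_le_pos D y, mult_congr hy ▸ pos_le_mult D y⟩
  have hcard : #((univ.filter fun y => Parallel D y x).image (pos D)) = mult D x := by
    rw [card_image_of_injOn]
    · unfold mult
      congr!
    · intro y hy z hz h
      have hy : Parallel D y x := by simpa using hy
      have hz : Parallel D z x := by simpa using hz
      exact eq_of_pos_eq (hy.trans hz.symm) h
  have heq := eq_of_subset_of_card_le hsub (by rw [hcard]; simp)
  have : n ∈ (univ.filter fun y => Parallel D y x).image (pos D) := heq ▸ mem_Icc.2 ⟨h1, h2⟩
  obtain ⟨y, hy, rfl⟩ := mem_image.1 this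
  exact ⟨y, by simpa using hy, rfl⟩

/-- The left endpoints of the last two arcs of the class of `x` are interchanged. -/
abbrev Crossed (D : List (Arc F)) (x : Fin D.length) : Prop :=
  1 < mult D x ∧ wt (D : Multiset (Arc F)) (D.get x).src (D.get x).tgt = 0

theorem crossed_congr {D : List (Arc F)} {x y : Fin D.length} (h : Parallel D x y) :
    Crossed D x ↔ Crossed D y := by
  unfold Crossed; rw [mult_congr h, h.1, h.2]

theorem leftHeight_le_mult (D : List (Arc F)) (x : Fin D.length) : leftHeight D x ≤ mult D x := by
  have := pos_le_mult D x
  unfold leftHeight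
  split_ifs <;> omega

theorem eq_of_leftHeight_eq {D : List (Arc F)} {x y : Fin D.length} (h : Parallel D x y)
    (hp : leftHeight D x = leftHeight D y) : x = y := by
  refine eq_of_pos_eq h ?_
  have h1 := one_le_pos D x
  have h2 := one_le_pos D y
  have h3 := pos_le_mult D x
  have h4 := pos_le_mult D y
  have h5 := mult_congr h
  have h6 := crossed_congr h
  unfold leftHeight at hp
  by_cases hc : Crossed D x
  · rw [if_pos hc, if_pos (h6.1 hc)] at hp
    have := hc.1
    split_ifs at hp <;> omega
  · rwa [if_neg hc, if_neg (h6.not.1 hc)] at hp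

/-- `x` starts below no other arc. -/
def IsTop (D : List (Arc F)) (x : Fin D.length) : Prop := ¬ ∃ y, StartsBelow D x y

/-- `x` ends below no other arc. -/
def IsBot (D : List (Arc F)) (x : Fin D.length) : Prop := ¬ ∃ y, EndsBelow D x y

theorem IsTop.eq {D : List (Arc F)} {x y : Fin D.length} (hx : IsTop D x) (hy : IsTop D y)
    (h : (D.get x).src = (D.get y).src) : x = y := by
  rcases lt_trichotomy (D.get x).tgt (D.get y).tgt with ht | ht | ht
  · exact absurd ⟨y, h, Or.inl ht⟩ hx
  · rcases lt_trichotomy (leftHeight D x) (leftHeight D y) with hl | hl | hl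
    · exact absurd ⟨y, h, Or.inr ⟨ht, hl⟩⟩ hx
    · exact eq_of_leftHeight_eq ⟨h, ht⟩ hl
    · exact absurd ⟨x, h.symm, Or.inr ⟨ht.symm, hl⟩⟩ hy
  · exact absurd ⟨x, h.symm, Or.inl ht⟩ hy

theorem IsBot.eq {D : List (Arc F)} {x y : Fin D.length} (hx : IsBot D x) (hy : IsBot D y)
    (h : (D.get x).tgt = (D.get y).tgt) : x = y := by
  rcases lt_trichotomy (D.get x).src (D.get y).src with ht | ht | ht
  · exact absurd ⟨x, h.symm, Or.inl ht⟩ hy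
  · rcases lt_trichotomy (pos D x) (pos D y) with hl | hl | hl
    · exact absurd ⟨y, h, Or.inr ⟨ht, hl⟩⟩ hx
    · exact eq_of_pos_eq ⟨ht, h⟩ hl
    · exact absurd ⟨x, h.symm, Or.inr ⟨ht.symm, hl⟩⟩ hy
  · exact absurd ⟨y, h, Or.inl ht⟩ hx

theorem exists_isTop (D : List (Arc F)) (x : Fin D.length) :
    ∃ y, (D.get y).src = (D.get x).src ∧ (D.get x).tgt ≤ (D.get y).tgt ∧ IsTop D y := by
  obtain ⟨y, hy, hmax⟩ := exists_max_image (univ.filter fun y => (D.get y).src = (D.get x).src)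
    (fun y => toLex ((D.get y).tgt, leftHeight D y)) ⟨x, by simp⟩
  have hy : (D.get y).src = (D.get x).src := (mem_filter.1 hy).2
  refine ⟨y, hy, ?_, ?_⟩
  · have := hmax x (by simp)
    rcases Prod.Lex.toLex_le_toLex.1 this with h | h
    exacts [h.le, h.1.le]
  · rintro ⟨z, hz, hlt⟩
    have := hmax z (by rw [mem_filter]; exact ⟨mem_univ _, hz.symm.trans hy⟩)
    exact not_lt.2 this (Prod.Lex.toLex_lt_toLex.2 hlt)

theorem exists_isBot (D : List (Arc F)) (x : Fin D.length) :
    ∃ y, (D.get y).tgt = (D.get x).tgt ∧ (D.get y).src ≤ (D.get x).src ∧ IsBot D y := by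
  obtain ⟨y, hy, hmax⟩ := exists_max_image (univ.filter fun y => (D.get y).tgt = (D.get x).tgt)
    (fun y => toLex (OrderDual.toDual (D.get y).src, pos D y)) ⟨x, by simp⟩
  have hy : (D.get y).tgt = (D.get x).tgt := (mem_filter.1 hy).2
  refine ⟨y, hy, ?_, ?_⟩
  · have := hmax x (by simp)
    rcases Prod.Lex.toLex_le_toLex.1 this with h | h
    exacts [(OrderDual.toDual_lt_toDual.1 h).le, (OrderDual.toDual_inj.1 h.1).ge]
  · rintro ⟨z, hz, hlt⟩
    have := hmax z (by rw [mem_filter]; exact ⟨mem_univ _, hz.symm.trans hy⟩)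
    refine not_lt.2 this (Prod.Lex.toLex_lt_toLex.2 ?_)
    rcases hlt with h | h
    exacts [Or.inl (OrderDual.toDual_lt_toDual.2 h), Or.inr ⟨congrArg OrderDual.toDual h.1, h.2⟩]

theorem IsBot.pos_eq {D : List (Arc F)} {x : Fin D.length} (hx : IsBot D x) : pos D x = mult D x := by
  obtain ⟨y, hy, hp⟩ := exists_pos_eq x ((one_le_pos D x).trans (pos_le_mult D x)) le_rfl
  by_contra hne
  exact hx ⟨y, hy.2.symm, Or.inr ⟨hy.1.symm, by
    have := pos_le_mult D x
    unfold rightHeight; omega⟩⟩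

theorem IsTop.leftHeight_eq {D : List (Arc F)} {x : Fin D.length} (hx : IsTop D x) :
    leftHeight D x = mult D x := by
  have hm : 1 ≤ mult D x := (one_le_pos D x).trans (pos_le_mult D x)
  obtain ⟨y, hy, hp⟩ : ∃ y, Parallel D y x ∧ leftHeight D y = mult D x := by
    by_cases hc : Crossed D x
    · have := hc.1
      -- After the interchange, the highest left end belongs to the arc in the last position but
      -- one.
      obtain ⟨y, hy, hp⟩ := exists_pos_eq x (n := mult D x - 1) (by omega) (by omega)
      refine ⟨y, hy, ?_⟩
      rw [leftHeight, if_pos ((crossed_congr hy).2 hc), mult_congr hy, if_neg (by omega), if_pos hp]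
    · obtain ⟨y, hy, hp⟩ := exists_pos_eq x hm le_rfl
      exact ⟨y, hy, by rw [leftHeight, if_neg ((crossed_congr hy).not.2 hc), hp]⟩
  by_contra hne
  exact hx ⟨y, hy.1.symm, Or.inr ⟨hy.2.symm, by
    have := leftHeight_le_mult D x
    omega⟩⟩

/-- In a class of weight zero with several arcs, the interchange separates the highest left end from
the highest right end; a class with a single arc has the label as its weight. -/
theorem wt_ne_zero_of_isTop_of_isBot {D : List (Arc F)} {x : Fin D.length} (ht : IsTop D x)
    (hb : IsBot D x) : wt (D : Multiset (Arc F)) (D.get x).src (D.get x).tgt ≠ 0 := by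
  have h1 := ht.leftHeight_eq
  have h2 := hb.pos_eq
  intro h0
  by_cases hm : 1 < mult D x
  · rw [leftHeight, if_pos ⟨hm, h0⟩, if_pos h2] at h1
    omega
  · have hx : ∀ y, Parallel D y x → y = x := fun y hy => by
      refine eq_of_pos_eq hy ?_
      have := one_le_pos D y
      have := pos_le_mult D y
      have := mult_congr hy
      have := one_le_pos D x
      omega
    rw [wt_coe_list, sum_eq_single x] at h0
    · exact (D.get x).label.ne_zero h0
    · intro y hy hyx
      exact absurd (hx y (mem_filter.1 hy).2) hyx
    · simp

/-- Without an interchange the left and right heights agree, and the same arc is highest at both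
ends. -/
theorem wt_eq_zero_of_isTop_of_isBot {D : List (Arc F)} {x y : Fin D.length} (ht : IsTop D x)
    (hb : IsBot D y) (hp : Parallel D x y) (hxy : x ≠ y) :
    wt (D : Multiset (Arc F)) (D.get x).src (D.get x).tgt = 0 := by
  have h1 := ht.leftHeight_eq
  have h2 := hb.pos_eq
  by_contra h0
  rw [leftHeight, if_neg fun h => h0 h.2] at h1
  exact hxy (eq_of_pos_eq hp (by rw [h1, h2, mult_congr hp]))

/-! ### The arc system of a diagram, and matchings as injections. -/

variable {K : Finset ℕ+} {D : List (Arc F)}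

/-- The arc system of a diagram with endpoints in `K`. -/
noncomputable def diagramSystem (hs : ∀ α ∈ D, α.src ∈ K) (ht : ∀ α ∈ D, α.tgt ∈ K) :
    ArcSystem (Fin D.length) K F where
  src x := ⟨(D.get x).src, hs _ (D.get_mem x)⟩
  tgt x := ⟨(D.get x).tgt, ht _ (D.get_mem x)⟩
  src_lt_tgt x := (D.get x).src_lt_tgt
  coeff x := (D.get x).label
  coeff_ne_zero x := (D.get x).label.ne_zero
  top x := (exists_isTop D x).choose
  bot x := (exists_isBot D x).choose
  src_top x := Subtype.ext (exists_isTop D x).choose_spec.1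
  tgt_le_tgt_top x := (exists_isTop D x).choose_spec.2.1
  top_congr x y h := (exists_isTop D x).choose_spec.2.2.eq (exists_isTop D y).choose_spec.2.2
    ((exists_isTop D x).choose_spec.1.trans
      ((congrArg Subtype.val h).trans (exists_isTop D y).choose_spec.1.symm))
  tgt_bot x := Subtype.ext (exists_isBot D x).choose_spec.1
  src_bot_le_src x := (exists_isBot D x).choose_spec.2.1
  bot_congr x y h := (exists_isBot D x).choose_spec.2.2.eq (exists_isBot D y).choose_spec.2.2
    ((exists_isBot D x).choose_spec.1.trans
      ((congrArg Subtype.val h).trans (exists_isBot D y).choose_spec.1.symm))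
  weight_ne_zero x htop hbot := by
    have h1 := (exists_isTop D x).choose_spec.2.2
    have h2 := (exists_isBot D x).choose_spec.2.2
    rw [htop] at h1
    rw [hbot] at h2
    have := wt_ne_zero_of_isTop_of_isBot h1 h2
    rw [wt_coe_list] at this
    simpa only [Subtype.mk.injEq] using this
  weight_eq_zero x y htop hbot hxy hxy' hne := by
    have h1 := (exists_isTop D x).choose_spec.2.2
    have h2 := (exists_isBot D y).choose_spec.2.2
    rw [htop] at h1
    rw [hbot] at h2
    have := wt_eq_zero_of_isTop_of_isBot h1 h2
      ⟨congrArg Subtype.val hxy, congrArg Subtype.val hxy'⟩ hne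
    rw [wt_coe_list] at this
    simpa only [Subtype.mk.injEq] using this

variable (hs : ∀ α ∈ D, α.src ∈ K) (ht : ∀ α ∈ D, α.tgt ∈ K)

theorem diagramSystem_top_eq_iff (x : Fin D.length) : (diagramSystem hs ht).top x = x ↔ IsTop D x :=
  ⟨fun h => by
    have := (exists_isTop D x).choose_spec.2.2
    exact h ▸ this,
  fun h => (exists_isTop D x).choose_spec.2.2.eq h (exists_isTop D x).choose_spec.1⟩

theorem diagramSystem_bot_eq_iff (x : Fin D.length) : (diagramSystem hs ht).bot x = x ↔ IsBot D x :=
  ⟨fun h => by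
    have := (exists_isBot D x).choose_spec.2.2
    exact h ▸ this,
  fun h => (exists_isBot D x).choose_spec.2.2.eq h (exists_isBot D x).choose_spec.1⟩

/-- All endpoints lie in `K`, so hollow marks come from stacking alone. -/
theorem marks_eq_filled_iff (x : Fin D.length) : marks K D x = (Mark.filled, Mark.filled) ↔
    (diagramSystem hs ht).top x = x ∧ (diagramSystem hs ht).bot x = x := by
  rw [diagramSystem_top_eq_iff, diagramSystem_bot_eq_iff, marks, Prod.mk.injEq, IsTop, IsBot]
  have h1 : (D.get x).src ∈ K := hs _ (D.get_mem x)
  have h2 : (D.get x).tgt ∈ K := ht _ (D.get_mem x)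
  split_ifs <;> simp_all

theorem marks_eq_hollow_iff (x : Fin D.length) : marks K D x = (Mark.hollow, Mark.hollow) ↔
    (diagramSystem hs ht).top x ≠ x ∧ (diagramSystem hs ht).bot x ≠ x := by
  rw [Ne, Ne, diagramSystem_top_eq_iff, diagramSystem_bot_eq_iff, marks, Prod.mk.injEq, IsTop, IsBot]
  have h1 : (D.get x).src ∈ K := hs _ (D.get_mem x)
  have h2 : (D.get x).tgt ∈ K := ht _ (D.get_mem x)
  split_ifs <;> simp_all

theorem hasCompleteMatching_iff (K : Finset ℕ+) (D : List (Arc F)) : HasCompleteMatching K D ↔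
    ∃ f : FilledVertex K D → HollowVertex K D, Function.Injective f ∧ ∀ y, Nested D y.1 (f y).1 := by
  constructor
  · rintro ⟨M, hM, hcov⟩
    have h : ∀ y : FilledVertex K D, ∃ x : HollowVertex K D, M.Adj (Sum.inl y) (Sum.inr x) := fun y => by
      obtain ⟨w, hw, -⟩ := hM (hcov y)
      rcases w with w | w
      · exact (M.adj_sub hw).elim
      · exact ⟨w, hw⟩
    choose f hf using h
    refine ⟨f, fun y z hyz => ?_, fun y => M.adj_sub (hf y)⟩
    have h1 := (hf y).symm
    have h2 := (hf z).symm
    rw [hyz] at h1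
    exact Sum.inl_injective (hM.eq_of_adj_left h1 h2)
  · rintro ⟨f, hf, hn⟩
    refine ⟨⨆ y : FilledVertex K D, (diagramGraph K D).subgraphOfAdj
      (show (diagramGraph K D).Adj (Sum.inl y) (Sum.inr (f y)) from hn y), ?_, fun y => ?_⟩
    · refine SimpleGraph.Subgraph.IsMatching.iSup
        (fun y => SimpleGraph.Subgraph.IsMatching.subgraphOfAdj _) fun y z hyz => ?_
      change Disjoint (SimpleGraph.Subgraph.support _) (SimpleGraph.Subgraph.support _)
      rw [SimpleGraph.support_subgraphOfAdj, SimpleGraph.support_subgraphOfAdj]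
      simp [Ne.symm hyz, hf.ne (Ne.symm hyz)]
    · rw [SimpleGraph.Subgraph.verts_iSup]
      exact Set.mem_iUnion.2 ⟨y, by simp⟩

theorem hasCompleteMatching_iff_exists_isSolution :
    HasCompleteMatching K D ↔ ∃ P Q, (diagramSystem hs ht).IsSolution P Q := by
  rw [hasCompleteMatching_iff, ArcSystem.exists_isSolution_iff]
  let e₁ : FilledVertex K D ≃ (diagramSystem hs ht).Filled :=
    Equiv.subtypeEquivRight (marks_eq_filled_iff hs ht)
  let e₂ : HollowVertex K D ≃ (diagramSystem hs ht).Hollow :=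
    Equiv.subtypeEquivRight (marks_eq_hollow_iff hs ht)
  constructor
  · rintro ⟨f, hf, hn⟩
    exact ⟨fun y => e₂ (f (e₁.symm y)), e₂.injective.comp (hf.comp e₁.symm.injective),
      fun y => hn (e₁.symm y)⟩
  · rintro ⟨f, hf, hn⟩
    exact ⟨fun y => e₂.symm (f (e₁ y)), e₂.symm.injective.comp (hf.comp e₁.injective),
      fun y => hn (e₁ y)⟩

end UnitriSuper

/-! ### Superclass representatives by elimination. -/

namespace UnitriSuper

variable {F : Type*} [Field F] {K : Finset ℕ+}

/-- The matrix of an element of the unitriangular group. -/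
abbrev unitriMatrix (u : unitri F K) : Matrix K K F := ((u : GL K F) : Matrix K K F)

theorem unitriMatrix_mul (u v : unitri F K) :
    unitriMatrix (u * v) = unitriMatrix u * unitriMatrix v := rfl

theorem unitriMatrix_mul_inv (u : unitri F K) : unitriMatrix u * unitriMatrix u⁻¹ = 1 := by
  rw [← unitriMatrix_mul, mul_inv_cancel]; rfl

theorem unitriMatrix_inv_mul (u : unitri F K) : unitriMatrix u⁻¹ * unitriMatrix u = 1 := by
  rw [← unitriMatrix_mul, inv_mul_cancel]; rfl

theorem unitriMatrix_of_lt (u : unitri F K) {i j : K} (h : j < i) : unitriMatrix u i j = 0 := u.2.1 h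

theorem unitriMatrix_diag (u : unitri F K) (i : K) : unitriMatrix u i i = 1 := u.2.2 i

theorem unitriMatrix_injective : Function.Injective (unitriMatrix (F := F) (K := K)) :=
  fun _ _ h => Subtype.ext (Units.ext h)

theorem sub_one_apply_eq_zero (u : unitri F K) {j k : K} (h : ¬ j < k) :
    (unitriMatrix u - 1) j k = 0 := by
  rcases (not_lt.1 h).lt_or_eq with h | rfl
  · rw [Matrix.sub_apply, unitriMatrix_of_lt u h, Matrix.one_apply_ne h.ne', sub_zero]
  · rw [Matrix.sub_apply, unitriMatrix_diag, Matrix.one_apply_eq, sub_self]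

theorem exists_unitriMatrix_eq {A : Matrix K K F} (h0 : ∀ i j, j < i → A i j = 0)
    (h1 : ∀ i, A i i = 1) : ∃ u : unitri F K, unitriMatrix u = A := by
  have ht : A.IsUpperTriangular := fun i j h => h0 i j h
  have hdet : A.det ≠ 0 := by
    rw [Matrix.det_of_isUpperTriangular ht, prod_congr rfl fun i _ => h1 i, prod_const_one]
    exact one_ne_zero
  exact ⟨⟨Matrix.GeneralLinearGroup.mkOfDetNeZero A hdet, ht, h1⟩, rfl⟩

/-- The matrix has at most one nonzero entry in each of the rows in `s`, and these entries lie in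
different columns. -/
def IsMonomialOn (s : Finset K) (N : Matrix K K F) : Prop :=
  (∀ r ∈ s, ∀ c c', N r c ≠ 0 → N r c' ≠ 0 → c = c') ∧
    ∀ r ∈ s, ∀ r' ∈ s, ∀ c, N r c ≠ 0 → N r' c ≠ 0 → r = r'

/-- Multiples of rows in `s`, all below row `a`, are added to row `a`. Their nonzero entries lie in
different columns, so the clearing steps do not interfere. -/
theorem exists_row_elimination (N : Matrix K K F) {a : K} {s : Finset K} (has : ∀ x ∈ s, a < x)
    (hN : IsMonomialOn s N) : ∃ x : unitri F K,
      (∀ r, r ≠ a → ∀ c, (unitriMatrix x * N) r c = N r c) ∧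
        ∀ r ∈ s, ∀ c, N r c ≠ 0 → (unitriMatrix x * N) a c = 0 := by
  classical
  let g : K → F := fun r => if h : ∃ c, N r c ≠ 0 then - (N a h.choose / N r h.choose) else 0
  obtain ⟨x, hx⟩ := exists_unitriMatrix_eq (F := F) (K := K)
    (A := 1 + Matrix.of fun r r' => if r = a ∧ r' ∈ s then g r' else 0)
    (fun i j hij => by
      rw [Matrix.add_apply, Matrix.one_apply_ne hij.ne', Matrix.of_apply, zero_add, if_neg]
      rintro ⟨rfl, h⟩
      exact absurd hij (has j h).not_gt)
    (fun i => by
      rw [Matrix.add_apply, Matrix.one_apply_eq, Matrix.of_apply, if_neg, add_zero]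
      rintro ⟨rfl, h⟩
      exact lt_irrefl _ (has i h))
  refine ⟨x, fun r hr c => ?_, fun r hr c hc => ?_⟩
  · rw [hx, Matrix.add_mul, Matrix.one_mul, Matrix.add_apply, Matrix.mul_apply]
    simp [hr]
  · rw [hx, Matrix.add_mul, Matrix.one_mul, Matrix.add_apply, Matrix.mul_apply,
      sum_eq_single r]
    · have h : ∃ c, N r c ≠ 0 := ⟨c, hc⟩
      have hcc : h.choose = c := hN.1 r hr _ _ h.choose_spec hc
      simp only [Matrix.of_apply, hr, and_true, if_true, g, dif_pos h, hcc]
      field_simp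
      ring
    · intro r' _ hr'
      rw [Matrix.of_apply]
      split_ifs with h
      · have : N r' c = 0 := by
          by_contra h'
          exact hr' (hN.2 r' h.2 r hr c h' hc)
        rw [this, mul_zero]
      · rw [zero_mul]
    · simp

theorem exists_column_elimination (N : Matrix K K F) {a c : K} (hc : N a c ≠ 0)
    (hlt : ∀ c', c' < c → N a c' = 0) : ∃ y : unitri F K,
      (∀ r, N r c = 0 → ∀ c', (N * unitriMatrix y) r c' = N r c') ∧
        ∀ c', c' ≠ c → (N * unitriMatrix y) a c' = 0 := by
  classical
  obtain ⟨y, hy⟩ := exists_unitriMatrix_eq (F := F) (K := K)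
    (A := 1 + Matrix.of fun r r' => if r = c ∧ c < r' then - (N a r' / N a c) else 0)
    (fun i j hij => by
      rw [Matrix.add_apply, Matrix.one_apply_ne hij.ne', Matrix.of_apply, zero_add, if_neg]
      rintro ⟨rfl, h⟩
      exact absurd hij h.not_gt)
    (fun i => by
      rw [Matrix.add_apply, Matrix.one_apply_eq, Matrix.of_apply, if_neg, add_zero]
      rintro ⟨rfl, h⟩
      exact lt_irrefl _ h)
  have key : ∀ r c', (N * unitriMatrix y) r c' =
      N r c' + N r c * if c < c' then - (N a c' / N a c) else 0 := by
    intro r c'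
    rw [hy, Matrix.mul_add, Matrix.mul_one, Matrix.add_apply, Matrix.mul_apply, sum_eq_single c]
    · simp
    · intro b _ hb
      simp [hb]
    · simp
  refine ⟨y, fun r hr c' => by rw [key, hr, zero_mul, add_zero], fun c' hc' => ?_⟩
  rw [key]
  rcases lt_or_gt_of_ne hc' with h | h
  · rw [hlt c' h, if_neg h.not_gt]; simp
  · rw [if_pos h]; field_simp; ring

/-- Rows are treated from the bottom up. The new row is first cleared in the columns occupied below
it; its leftmost remaining entry then clears the row to its right. The second operation spares the
rows below, which are zero in the pivot column. -/
theorem exists_isMonomialOn (N : Matrix K K F) (s : Finset K) :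
    ∃ x y : unitri F K, IsMonomialOn s (unitriMatrix x * N * unitriMatrix y) := by
  classical
  induction s using Finset.induction_on_min with
  | empty => exact ⟨1, 1, by simp, by simp⟩
  | insert a s has ih =>
    obtain ⟨x, y, hxy⟩ := ih
    set N₁ := unitriMatrix x * N * unitriMatrix y
    obtain ⟨x', hx₁, hx₂⟩ := exists_row_elimination N₁ has hxy
    set N₂ := unitriMatrix x' * N₁ with hN₂
    have hne : ∀ r ∈ s, r ≠ a := fun r hr => (has r hr).ne'
    have hmon : IsMonomialOn s N₂ := by
      refine ⟨fun r hr c c' => ?_, fun r hr r' hr' c => ?_⟩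
      · rw [hx₁ r (hne r hr), hx₁ r (hne r hr)]; exact hxy.1 r hr c c'
      · rw [hx₁ r (hne r hr), hx₁ r' (hne r' hr')]; exact hxy.2 r hr r' hr' c
    have hcol : ∀ r ∈ s, ∀ c, N₂ a c ≠ 0 → N₂ r c = 0 := fun r hr c hc => by
      rw [hx₁ r (hne r hr)]
      by_contra h
      exact hc (hx₂ r hr c h)
    by_cases hz : ∀ c, N₂ a c = 0
    · refine ⟨x' * x, y, ?_⟩
      have : unitriMatrix (x' * x) * N * unitriMatrix y = N₂ := by
        rw [unitriMatrix_mul, hN₂]; simp only [N₁, Matrix.mul_assoc]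
      rw [this]
      refine ⟨fun r hr c c' h h' => ?_, fun r hr r' hr' c h h' => ?_⟩
      · rcases mem_insert.1 hr with rfl | hr
        · exact absurd (hz c) h
        · exact hmon.1 r hr c c' h h'
      · rcases mem_insert.1 hr with rfl | hr
        · exact absurd (hz c) h
        · rcases mem_insert.1 hr' with rfl | hr'
          · exact absurd (hz c) h'
          · exact hmon.2 r hr r' hr' c h h'
    · push Not at hz
      obtain ⟨c₀, hc₀⟩ := hz
      obtain ⟨c, hc, hmin⟩ := exists_min_image (univ.filter fun c => N₂ a c ≠ 0) id
        ⟨c₀, by simpa using hc₀⟩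
      have hc : N₂ a c ≠ 0 := (mem_filter.1 hc).2
      have hmin : ∀ c', c' < c → N₂ a c' = 0 := fun c' hlt => by
        by_contra h
        exact absurd hlt (not_lt.2 (hmin c' (by simpa using h)))
      obtain ⟨y', hy₁, hy₂⟩ := exists_column_elimination N₂ hc hmin
      refine ⟨x' * x, y * y', ?_⟩
      have : unitriMatrix (x' * x) * N * unitriMatrix (y * y') = N₂ * unitriMatrix y' := by
        rw [unitriMatrix_mul, unitriMatrix_mul, hN₂]; simp only [N₁, Matrix.mul_assoc]
      rw [this]
      set N₃ := N₂ * unitriMatrix y'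
      have hs : ∀ r ∈ s, ∀ c', N₃ r c' = N₂ r c' := fun r hr => hy₁ r (hcol r hr c hc)
      have ha : ∀ c', N₃ a c' ≠ 0 → c' = c := fun c' h => by
        by_contra h'
        exact h (hy₂ c' h')
      have has' : ∀ r ∈ s, ∀ c', N₃ a c' ≠ 0 → N₃ r c' = 0 := fun r hr c' h => by
        rw [hs r hr, ha c' h, hcol r hr c hc]
      refine ⟨fun r hr c c' h h' => ?_, fun r hr r' hr' c h h' => ?_⟩
      · rcases mem_insert.1 hr with rfl | hr
        · rw [ha c h, ha c' h']
        · rw [hs r hr] at h h'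
          exact hmon.1 r hr c c' h h'
      · rcases mem_insert.1 hr with rfl | hr₁
        · rcases mem_insert.1 hr' with rfl | hr'
          · rfl
          · exact absurd (has' r' hr' c h) h'
        · rcases mem_insert.1 hr' with rfl | hr'
          · exact absurd (has' r hr₁ c h') h
          · rw [hs r hr₁] at h
            rw [hs r' hr'] at h'
            exact hmon.2 r hr₁ r' hr' c h h'

theorem exists_isQSetPartition_arcMatrix_eq {N : Matrix K K F} (hlt : ∀ j k, N j k ≠ 0 → j < k)
    (hN : IsMonomialOn univ N) : ∃ μ : Multiset (Arc F), IsQSetPartition K μ ∧ arcMatrix K μ = N := by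
  classical
  let I := {p : K × K // N p.1 p.2 ≠ 0}
  let arc : I → Arc F := fun p => ⟨p.1.1, p.1.2, hlt _ _ p.2, Units.mk0 _ p.2⟩
  refine ⟨(univ : Finset I).val.map arc, ⟨?_, ?_, ?_, ?_⟩, ?_⟩
  · intro α hα
    obtain ⟨p, -, rfl⟩ := Multiset.mem_map.1 hα
    exact p.1.1.2
  · intro α hα
    obtain ⟨p, -, rfl⟩ := Multiset.mem_map.1 hα
    exact p.1.2.2
  · rw [Multiset.map_map]
    refine univ.nodup.map fun p p' h => ?_
    have h : p.1.1 = p'.1.1 := Subtype.ext h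
    have h' : p.1.2 = p'.1.2 := hN.1 p.1.1 (mem_univ _) _ _ p.2 (h ▸ p'.2)
    exact Subtype.ext (Prod.ext h h')
  · rw [Multiset.map_map]
    refine univ.nodup.map fun p p' h => ?_
    have h : p.1.2 = p'.1.2 := Subtype.ext h
    have h' : p.1.1 = p'.1.1 := hN.2 _ (mem_univ _) _ (mem_univ _) p.1.2 p.2 (h ▸ p'.2)
    exact Subtype.ext (Prod.ext h' h)
  · ext j k
    rw [arcMatrix, Matrix.of_apply, wt, sum_map_filter, Multiset.map_map]
    change ∑ p : I, (if (p.1.1 : ℕ+) = j ∧ (p.1.2 : ℕ+) = k then N p.1.1 p.1.2 else 0) = N j k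
    by_cases h : N j k = 0
    · rw [h]
      refine sum_eq_zero fun p _ => if_neg fun h' => p.2 ?_
      rw [Subtype.ext h'.1, Subtype.ext h'.2, h]
    · rw [sum_eq_single (⟨(j, k), h⟩ : I)]
      · simp
      · intro p _ hp
        exact if_neg fun h' => hp (Subtype.ext (Prod.ext (Subtype.ext h'.1) (Subtype.ext h'.2)))
      · simp

/-- Existence suffices: the values are later compared with a function of `u` that can be computed
from any representative, so uniqueness of the index plays no role. -/
theorem exists_inSuperclass (u : unitri F K) :
    ∃ μ : Multiset (Arc F), IsQSetPartition K μ ∧ InSuperclass K μ u := by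
  obtain ⟨x, y, hxy⟩ := exists_isMonomialOn (unitriMatrix u - 1) univ
  obtain ⟨μ, hμ, hμN⟩ := exists_isQSetPartition_arcMatrix_eq (fun j k h => by
    by_contra hle
    refine h ?_
    rw [Matrix.mul_apply]
    refine sum_eq_zero fun c _ => ?_
    by_cases hck : k < c
    · rw [unitriMatrix_of_lt y hck, mul_zero]
    · rw [Matrix.mul_apply, sum_eq_zero, zero_mul]
      intro b _
      by_cases hbj : b < j
      · rw [unitriMatrix_of_lt x hbj, zero_mul]
      · have : c ≤ b := (not_lt.1 hck).trans ((not_lt.1 hle).trans (not_lt.1 hbj))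
        rcases this.lt_or_eq with h | rfl
        · rw [Matrix.sub_apply, unitriMatrix_of_lt u h, Matrix.one_apply_ne h.ne', sub_zero, mul_zero]
        · rw [Matrix.sub_apply, unitriMatrix_diag u, Matrix.one_apply_eq, sub_self, mul_zero]) hxy
  refine ⟨μ, hμ, x⁻¹, y⁻¹, ?_⟩
  change unitriMatrix u = 1 + unitriMatrix x⁻¹ * arcMatrix K μ * unitriMatrix y⁻¹
  rw [hμN, ← Matrix.mul_assoc, ← Matrix.mul_assoc, unitriMatrix_inv_mul, Matrix.one_mul,
    Matrix.mul_assoc, unitriMatrix_mul_inv, Matrix.mul_one, add_sub_cancel]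

theorem superclassIndex_spec (u : unitri F K) :
    IsQSetPartition K (superclassIndex K u) ∧ InSuperclass K (superclassIndex K u) u :=
  Classical.epsilon_spec (exists_inSuperclass u)

theorem IsQSetPartition.wt_eq_label {μ : Multiset (Arc F)} (hμ : IsQSetPartition K μ) {β : Arc F}
    (hβ : β ∈ μ) : wt μ β.src β.tgt = β.label := by
  obtain ⟨t, rfl⟩ := Multiset.exists_cons_of_mem hβ
  have h := hμ.src_nodup
  rw [Multiset.map_cons, Multiset.nodup_cons] at h
  rw [wt, Multiset.filter_cons_of_pos _ ⟨rfl, rfl⟩, Multiset.filter_eq_nil.2]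
  · simp
  · rintro γ hγ ⟨h1, -⟩
    exact h.1 (Multiset.mem_map.2 ⟨γ, hγ, h1⟩)

theorem exists_mem_of_wt_ne_zero {μ : Multiset (Arc F)} {j k : ℕ+} (h : wt μ j k ≠ 0) :
    ∃ β ∈ μ, β.src = j ∧ β.tgt = k := by
  by_contra hne
  push Not at hne
  refine h ?_
  rw [wt, Multiset.filter_eq_nil.2]
  · simp
  · rintro β hβ ⟨h1, h2⟩
    exact hne β hβ h1 h2

theorem IsQSetPartition.wt_ne_zero_iff {μ : Multiset (Arc F)} (hμ : IsQSetPartition K μ) {j k : ℕ+} :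
    wt μ j k ≠ 0 ↔ ∃ β ∈ μ, β.src = j ∧ β.tgt = k := by
  refine ⟨exists_mem_of_wt_ne_zero, ?_⟩
  rintro ⟨β, hβ, rfl, rfl⟩
  rw [hμ.wt_eq_label hβ]
  exact β.label.ne_zero

theorem IsQSetPartition.isMonomialOn {μ : Multiset (Arc F)} (hμ : IsQSetPartition K μ) :
    IsMonomialOn univ (arcMatrix K μ) := by
  refine ⟨fun r _ c c' h h' => ?_, fun r _ r' _ c h h' => ?_⟩
  · obtain ⟨β, hβ, h1, h2⟩ := exists_mem_of_wt_ne_zero h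
    obtain ⟨γ, hγ, h3, h4⟩ := exists_mem_of_wt_ne_zero h'
    have := Multiset.inj_on_of_nodup_map hμ.src_nodup β hβ γ hγ (h1.trans h3.symm)
    exact Subtype.ext (by rw [← h2, ← h4, this])
  · obtain ⟨β, hβ, h1, h2⟩ := exists_mem_of_wt_ne_zero h
    obtain ⟨γ, hγ, h3, h4⟩ := exists_mem_of_wt_ne_zero h'
    have := Multiset.inj_on_of_nodup_map hμ.tgt_nodup β hβ γ hγ (h2.trans h4.symm)
    exact Subtype.ext (by rw [← h1, ← h3, this])

end UnitriSuper

/-! ### Arc characters as orbit sums. -/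

namespace UnitriSuper

variable {F : Type*} [Field F] {K : Finset ℕ+} (θ : AddChar F ℂ)

open Classical in
/-- The normalized contribution of the coordinate `j` of the left vector to an orbit sum. -/
noncomputable def rowFactor (a : F) (i j : K) (s : F) : ℂ :=
  if j < i then 1 else if j = i then θ (a * s) else if s = 0 then 1 else 0

theorem rowFactor_zero (a : F) (i j : K) : rowFactor θ a i j 0 = 1 := by
  simp [rowFactor]

theorem rowFactor_of_gt (a : F) {i j : K} (h : i < j) {s : F} (hs : s ≠ 0) :
    rowFactor θ a i j s = 0 := by
  rw [rowFactor, if_neg h.not_gt, if_neg h.ne', if_neg hs]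

/-- With at most one nonzero term, multiplicativity only needs the value 1 at zero. This is what
lets the factors of a monomial matrix be regrouped by columns. -/
theorem rowFactor_sum (a : F) (i j : K) (f : K → F) (hf : ∀ c c', f c ≠ 0 → f c' ≠ 0 → c = c') :
    rowFactor θ a i j (∑ k, f k) = ∏ k, rowFactor θ a i j (f k) := by
  by_cases h : ∃ c, f c ≠ 0
  · obtain ⟨c, hc⟩ := h
    have h0 : ∀ k, k ≠ c → f k = 0 := fun k hk => by
      by_contra h'; exact hk (hf k c h' hc)
    rw [sum_eq_single c (fun k _ hk => h0 k hk) (by simp),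
      prod_eq_single c (fun k _ hk => by rw [h0 k hk, rowFactor_zero]) (by simp)]
  · push Not at h
    simp [h, rowFactor_zero]

theorem addChar_map_sum {ι : Type*} (s : Finset ι) (f : ι → F) :
    θ (∑ x ∈ s, f x) = ∏ x ∈ s, θ (f x) := by
  classical
  induction s using Finset.induction_on with
  | empty => simp
  | insert a s ha ih => rw [sum_insert ha, prod_insert ha, AddChar.map_add_eq_mul, ih]

theorem prod_rowFactor (a : F) (i l : K) {N : Matrix K K F} (h : ∀ j, i < j → N j l = 0) :
    ∏ j, rowFactor θ a i j (N j l) = θ (a * N i l) := by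
  rw [prod_eq_single i]
  · simp [rowFactor]
  · intro j _ hj
    rcases lt_or_gt_of_ne hj with hj | hj
    · rw [rowFactor, if_pos hj]
    · rw [h j hj, rowFactor_zero]
  · simp

-- Right endpoints are distinct, so nested arcs can be counted by the columns they occupy.
open Classical in
theorem card_filter_eq {μ : Multiset (Arc F)} (hμ : IsQSetPartition K μ) (i l : K) :
    (μ.filter fun β => (i : ℕ+) < β.src ∧ β.tgt < (l : ℕ+)).card =
      #{k : K | k < l ∧ ∃ j, i < j ∧ arcMatrix K μ j k ≠ 0} := by
  have hnd : ((μ.filter fun β => (i : ℕ+) < β.src ∧ β.tgt < (l : ℕ+)).map Arc.tgt).Nodup :=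
    Multiset.nodup_of_le (Multiset.map_le_map (Multiset.filter_le _ _)) hμ.tgt_nodup
  rw [← Multiset.card_map Arc.tgt, ← Multiset.toFinset_card_of_nodup hnd,
    ← card_map (Function.Embedding.subtype fun k => k ∈ K)]
  congr 1
  ext k
  simp only [Multiset.mem_toFinset, Multiset.mem_map, Multiset.mem_filter, Finset.mem_map, mem_filter,
    mem_univ, true_and]
  constructor
  · rintro ⟨β, ⟨hβ, h1, h2⟩, rfl⟩
    exact ⟨⟨β.tgt, hμ.tgt_mem β hβ⟩, ⟨h2, ⟨β.src, hμ.src_mem β hβ⟩, h1,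
      hμ.wt_ne_zero_iff.2 ⟨β, hβ, rfl, rfl⟩⟩, rfl⟩
  · rintro ⟨k, ⟨h2, j, h1, h⟩, rfl⟩
    obtain ⟨β, hβ, hs, ht⟩ := hμ.wt_ne_zero_iff.1 h
    exact ⟨β, ⟨hβ, by rw [hs]; exact h1, by rw [ht]; exact h2⟩, ht⟩

variable [Fintype F]

open Classical in
/-- The vectors whose first nonzero entry is a `1` at `i`. -/
noncomputable def leadVectors (F : Type*) [Field F] [Fintype F] {K : Finset ℕ+} (i : K) :
    Finset (K → F) :=
  Fintype.piFinset fun j => if j < i then {0} else if j = i then {1} else univ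

open Classical in
/-- The vectors whose last nonzero entry is a `1` at `l`. -/
noncomputable def trailVectors (F : Type*) [Field F] [Fintype F] {K : Finset ℕ+} (l : K) :
    Finset (K → F) :=
  Fintype.piFinset fun k => if l < k then {0} else if k = l then {1} else univ

theorem mem_leadVectors {i : K} {p : K → F} :
    p ∈ leadVectors F i ↔ (∀ j, j < i → p j = 0) ∧ p i = 1 := by
  rw [leadVectors, Fintype.mem_piFinset]
  constructor
  · intro h
    refine ⟨fun j hj => ?_, ?_⟩
    · simpa [hj] using h j
    · simpa using h i
  · rintro ⟨h0, h1⟩ j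
    split_ifs with hj hj'
    · simpa using h0 j hj
    · simpa [hj'] using h1
    · simp

theorem mem_trailVectors {l : K} {q : K → F} :
    q ∈ trailVectors F l ↔ (∀ k, l < k → q k = 0) ∧ q l = 1 := by
  rw [trailVectors, Fintype.mem_piFinset]
  constructor
  · intro h
    refine ⟨fun j hj => ?_, ?_⟩
    · simpa [hj] using h j
    · simpa using h l
  · rintro ⟨h0, h1⟩ j
    split_ifs with hj hj'
    · simpa using h0 j hj
    · simpa [hj'] using h1
    · simp

theorem vecMul_mem_leadVectors {i : K} {p : K → F} (hp : p ∈ leadVectors F i) (x : unitri F K) :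
    p ᵥ* unitriMatrix x ∈ leadVectors F i := by
  rw [mem_leadVectors] at hp ⊢
  have key : ∀ j k, (k < i ∨ j < k) → p k * unitriMatrix x k j = 0 := by
    rintro j k (h | h)
    · rw [hp.1 k h, zero_mul]
    · rw [unitriMatrix_of_lt x h, mul_zero]
  refine ⟨fun j hj => sum_eq_zero fun k _ => key j k ?_, ?_⟩
  · rcases lt_or_ge k i with h | h
    exacts [Or.inl h, Or.inr (hj.trans_le h)]
  · rw [Matrix.vecMul, dotProduct, sum_eq_single i]
    · rw [hp.2, unitriMatrix_diag, one_mul]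
    · intro k _ hk
      exact key i k (lt_or_gt_of_ne hk)
    · simp

theorem mulVec_mem_trailVectors {l : K} {q : K → F} (hq : q ∈ trailVectors F l) (y : unitri F K) :
    unitriMatrix y *ᵥ q ∈ trailVectors F l := by
  rw [mem_trailVectors] at hq ⊢
  have key : ∀ j k, (l < k ∨ k < j) → unitriMatrix y j k * q k = 0 := by
    rintro j k (h | h)
    · rw [hq.1 k h, mul_zero]
    · rw [unitriMatrix_of_lt y h, zero_mul]
  refine ⟨fun j hj => sum_eq_zero fun k _ => key j k ?_, ?_⟩
  · rcases lt_or_ge l k with h | h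
    exacts [Or.inl h, Or.inr (h.trans_lt hj)]
  · rw [Matrix.mulVec, dotProduct, sum_eq_single l]
    · rw [hq.2, unitriMatrix_diag, one_mul]
    · intro k _ hk
      exact key l k (lt_or_gt_of_ne hk).symm
    · simp

/-- The sum over the orbit of the elementary functional at `(i, l)` of the corresponding additive
characters, evaluated at `N`. -/
noncomputable def orbitSum (a : F) (i l : K) (N : Matrix K K F) : ℂ :=
  ∑ p ∈ leadVectors F i, ∑ q ∈ trailVectors F l, θ (a * (p ⬝ᵥ N *ᵥ q))

/-- The unitriangular group permutes both ranges of summation, so x and y are absorbed into p and q.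
-/
theorem orbitSum_mul_mul (a : F) (i l : K) (N : Matrix K K F) (x y : unitri F K) :
    orbitSum θ a i l (unitriMatrix x * N * unitriMatrix y) = orbitSum θ a i l N := by
  have h : ∀ p q : K → F, p ⬝ᵥ (unitriMatrix x * N * unitriMatrix y) *ᵥ q =
      (p ᵥ* unitriMatrix x) ⬝ᵥ N *ᵥ (unitriMatrix y *ᵥ q) := fun p q => by
    rw [← Matrix.mulVec_mulVec, ← Matrix.mulVec_mulVec, Matrix.dotProduct_mulVec]
  unfold orbitSum
  refine sum_nbij' (fun p => p ᵥ* unitriMatrix x) (fun p => p ᵥ* unitriMatrix x⁻¹)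
    (fun p hp => vecMul_mem_leadVectors hp x) (fun p hp => vecMul_mem_leadVectors hp x⁻¹)
    (fun p _ => by rw [Matrix.vecMul_vecMul, unitriMatrix_mul_inv, Matrix.vecMul_one])
    (fun p _ => by rw [Matrix.vecMul_vecMul, unitriMatrix_inv_mul, Matrix.vecMul_one]) fun p _ => ?_
  refine sum_nbij' (fun q => unitriMatrix y *ᵥ q) (fun q => unitriMatrix y⁻¹ *ᵥ q)
    (fun p hp => mulVec_mem_trailVectors hp y) (fun p hp => mulVec_mem_trailVectors hp y⁻¹)
    (fun p _ => by rw [Matrix.mulVec_mulVec, unitriMatrix_inv_mul, Matrix.one_mulVec])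
    (fun p _ => by rw [Matrix.mulVec_mulVec, unitriMatrix_mul_inv, Matrix.one_mulVec]) fun q _ => ?_
  rw [h]

theorem sum_addChar_mul {θ : AddChar F ℂ} (hθ : θ ≠ 1) (b : F) [Decidable (b = 0)] :
    ∑ t, θ (b * t) = if b = 0 then (Fintype.card F : ℂ) else 0 := by
  classical
  have h := AddChar.sum_mulShift (ψ := θ) b (AddChar.IsPrimitive.of_ne_one hθ)
  simp only [mul_comm b]
  rw [h]
  split_ifs <;> simp

variable {θ}

theorem sum_row (hθ : θ ≠ 1) {a : F} (ha : a ≠ 0) (i j : K) (s : F) :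
    open Classical in
    ∑ t ∈ (if j < i then {0} else if j = i then {1} else univ : Finset F), θ (a * (t * s)) =
      (if i < j then (Fintype.card F : ℂ) else 1) * rowFactor θ a i j s := by
  classical
  unfold rowFactor
  rcases lt_trichotomy j i with h | h | h
  · simp [h, h.not_gt]
  · simp [h]
  · simp only [if_neg h.not_gt, if_neg h.ne', if_pos h]
    have : ∀ t, a * (t * s) = (a * s) * t := fun t => by ring
    simp only [this, sum_addChar_mul hθ (a * s), mul_eq_zero, ha, false_or]
    split_ifs <;> simp

/-- The sum over p factors over rows. Each row of N q has at most one nonzero term, so the result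
also factors over columns, and then so does the sum over q. -/
theorem orbitSum_eq_prod (hθ : θ ≠ 1) {a : F} (ha : a ≠ 0) (i l : K) {N : Matrix K K F}
    (hN : IsMonomialOn univ N) :
    open Classical in
    orbitSum θ a i l N = (∏ j : K, if i < j then (Fintype.card F : ℂ) else 1) *
      ∏ k, ∑ t ∈ (if l < k then {0} else if k = l then {1} else univ : Finset F),
        ∏ j, rowFactor θ a i j (N j k * t) := by
  classical
  rw [orbitSum, sum_comm, prod_univ_sum, mul_sum]
  refine sum_congr (by unfold trailVectors; congr!) fun q _ => ?_
  have h1 : ∀ p : K → F, θ (a * (p ⬝ᵥ N *ᵥ q)) = ∏ j, θ (a * (p j * (N *ᵥ q) j)) := fun p => by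
    rw [dotProduct, mul_sum, addChar_map_sum θ]
  rw [sum_congr rfl fun p _ => h1 p, leadVectors, ← prod_univ_sum
    (fun j => (if j < i then {0} else if j = i then {1} else univ : Finset F))
    (fun j t => θ (a * (t * (N *ᵥ q) j)))]
  simp only [sum_row hθ ha]
  rw [prod_mul_distrib]
  congr 1
  rw [prod_comm]
  refine prod_congr rfl fun j _ => ?_
  rw [Matrix.mulVec, dotProduct, rowFactor_sum]
  intro c c' h h'
  exact hN.1 j (mem_univ _) c c' (left_ne_zero_of_mul h) (left_ne_zero_of_mul h')

/-- An entry below row `i` forces the free coordinate of q to be zero; without one, that coordinate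
is unconstrained. -/
theorem sum_column_of_eq_zero (a : F) (i : K) {k : K} {N : Matrix K K F}
    (hik : N i k = 0) :
    open Classical in
    ∑ t : F, ∏ j, rowFactor θ a i j (N j k * t) =
      if ∃ j, i < j ∧ N j k ≠ 0 then 1 else (Fintype.card F : ℂ) := by
  classical
  split_ifs with h
  · obtain ⟨j, hj, hjk⟩ := h
    rw [sum_eq_single 0]
    · simp [rowFactor_zero]
    · intro t _ ht
      exact prod_eq_zero (mem_univ j) (rowFactor_of_gt θ a hj (mul_ne_zero hjk ht))
    · simp
  · push Not at h
    have : ∀ t j, rowFactor θ a i j (N j k * t) = 1 := fun t j => by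
      rcases lt_trichotomy j i with hj | rfl | hj
      · rw [rowFactor, if_pos hj]
      · rw [hik, zero_mul, rowFactor_zero]
      · rw [h j hj, zero_mul, rowFactor_zero]
    simp [this]

theorem sum_column_eq_zero (hθ : θ ≠ 1) {a : F} (ha : a ≠ 0) (i : K) {k : K} {N : Matrix K K F}
    (hN : IsMonomialOn univ N) (hik : N i k ≠ 0) :
    ∑ t : F, ∏ j, rowFactor θ a i j (N j k * t) = 0 := by
  classical
  have : ∀ t, ∏ j, rowFactor θ a i j (N j k * t) = θ (a * N i k * t) := fun t => by
    rw [prod_eq_single i]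
    · simp [rowFactor, mul_assoc]
    · intro j _ hj
      have : N j k = 0 := by
        by_contra h
        exact hj (hN.2 j (mem_univ _) i (mem_univ _) k h hik)
      rw [this, zero_mul, rowFactor_zero]
    · simp
  simp only [this, sum_addChar_mul hθ, mul_eq_zero, ha, hik, or_self, if_false]

/-- A column left of `l` with an entry below row `i` loses one factor q; these columns give the
denominator of the arc value. An entry of row `i` left of `l` produces a full nontrivial character
sum, and an entry of column `l` below row `i` a zero row factor: these are the two vanishing cases.
-/
theorem orbitSum_arcMatrix (hθ : θ ≠ 1) {α : Arc F} (hi : α.src ∈ K) (hl : α.tgt ∈ K)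
    {μ : Multiset (Arc F)} (hμ : IsQSetPartition K μ) :
    open Classical in
    ((Fintype.card F : ℂ) ^ (K.filter fun j => α.src < j ∧ j < α.tgt).card *
      orbitSum θ α.label ⟨α.src, hi⟩ ⟨α.tgt, hl⟩ (arcMatrix K μ)) =
      ((∏ j : K, if ⟨α.src, hi⟩ < j then (Fintype.card F : ℂ) else 1) *
        (Fintype.card F : ℂ) ^ #{k : K | k < ⟨α.tgt, hl⟩}) * arcValue θ K α μ := by
  classical
  set i : K := ⟨α.src, hi⟩
  set l : K := ⟨α.tgt, hl⟩
  have hα : (α.label : F) ≠ 0 := α.label.ne_zero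
  have hq : (Fintype.card F : ℂ) ≠ 0 := by simp
  have hN := hμ.isMonomialOn
  rw [orbitSum_eq_prod hθ hα i l hN, arcValue]
  have hcol : (∑ t ∈ (if l < l then {0} else if l = l then {1} else univ : Finset F),
      ∏ j, rowFactor θ (α.label : F) i j (arcMatrix K μ j l * t)) =
      ∏ j, rowFactor θ (α.label : F) i j (arcMatrix K μ j l) := by simp
  split_ifs with hβ
  · rw [mul_zero]
    obtain ⟨β, hβ, h | h⟩ := hβ
    · refine mul_eq_zero_of_right _ (mul_eq_zero_of_right _
        (prod_eq_zero (mem_univ ⟨β.tgt, hμ.tgt_mem β hβ⟩) ?_))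
      have hlt : (⟨β.tgt, hμ.tgt_mem β hβ⟩ : K) < l := h.2
      rw [if_neg hlt.not_gt, if_neg hlt.ne]
      exact sum_column_eq_zero hθ hα i hN (hμ.wt_ne_zero_iff.2 ⟨β, hβ, h.1.symm, rfl⟩)
    · refine mul_eq_zero_of_right _ (mul_eq_zero_of_right _ (prod_eq_zero (mem_univ l) ?_))
      rw [hcol]
      have hlt : i < (⟨β.src, hμ.src_mem β hβ⟩ : K) := h.1
      exact prod_eq_zero (mem_univ _) (rowFactor_of_gt θ _ hlt
        (hμ.wt_ne_zero_iff.2 ⟨β, hβ, rfl, h.2⟩))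
  · have hi0 : ∀ k, k < l → arcMatrix K μ i k = 0 := fun k hk => by
      by_contra h
      obtain ⟨β, hβ', hs, ht⟩ := hμ.wt_ne_zero_iff.1 h
      exact hβ ⟨β, hβ', Or.inl ⟨hs.symm, by rw [ht]; exact hk⟩⟩
    have hl0 : ∀ j, i < j → arcMatrix K μ j l = 0 := fun j hj => by
      by_contra h
      obtain ⟨β, hβ', hs, ht⟩ := hμ.wt_ne_zero_iff.1 h
      exact hβ ⟨β, hβ', Or.inr ⟨by rw [hs]; exact hj, ht⟩⟩
    have hprod : ∏ k, ∑ t ∈ (if l < k then {0} else if k = l then {1} else univ : Finset F),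
        ∏ j, rowFactor θ (α.label : F) i j (arcMatrix K μ j k * t) =
        ∏ k, (if k = l then θ (α.label * wt μ α.src α.tgt) else 1) *
          if k < l ∧ ¬ ∃ j, i < j ∧ arcMatrix K μ j k ≠ 0 then (Fintype.card F : ℂ) else 1 := by
      refine prod_congr rfl fun k _ => ?_
      rcases lt_trichotomy k l with h | rfl | h
      · rw [if_neg h.not_gt, if_neg h.ne, if_neg h.ne, sum_column_of_eq_zero _ i (hi0 k h)]
        by_cases hE : ∃ j, i < j ∧ arcMatrix K μ j k ≠ 0 <;> simp [hE, h]
      · rw [hcol, prod_rowFactor _ _ _ _ hl0]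
        simp only [if_true, lt_irrefl, false_and, if_false, mul_one]
        rfl
      · simp [h, h.ne', h.not_gt, rowFactor_zero]
    have hcard := card_filter_eq hμ i l
    have hpow : (∏ k, if k < l ∧ ¬ ∃ j, i < j ∧ arcMatrix K μ j k ≠ 0 then (Fintype.card F : ℂ) else 1) =
        (Fintype.card F : ℂ) ^ #{k : K | k < l ∧ ¬ ∃ j, i < j ∧ arcMatrix K μ j k ≠ 0} := by
      rw [← prod_filter, prod_const]
    rw [hprod, prod_mul_distrib, prod_ite_eq', if_pos (mem_univ _), hpow, hcard]
    have hsplit : #{k : K | k < l} = #{k : K | k < l ∧ ∃ j, i < j ∧ arcMatrix K μ j k ≠ 0} +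
        #{k : K | k < l ∧ ¬ ∃ j, i < j ∧ arcMatrix K μ j k ≠ 0} := by
      rw [← card_filter_add_card_filter_not (s := univ.filter fun k : K => k < l)
        (fun k => ∃ j, i < j ∧ arcMatrix K μ j k ≠ 0), filter_filter, filter_filter]
    rw [hsplit, pow_add]
    field_simp

theorem exists_arcValue_eq_mul_orbitSum (hθ : θ ≠ 1) {α : Arc F} (hi : α.src ∈ K) (hl : α.tgt ∈ K) :
    ∃ C : ℂ, C ≠ 0 ∧ ∀ u : unitri F K, arcValue θ K α (superclassIndex K u) =
      C * orbitSum θ α.label ⟨α.src, hi⟩ ⟨α.tgt, hl⟩ (unitriMatrix u - 1) := by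
  classical
  have hq : (Fintype.card F : ℂ) ≠ 0 := by simp
  set A : ℂ := (Fintype.card F : ℂ) ^ (K.filter fun j => α.src < j ∧ j < α.tgt).card
  set B : ℂ := (∏ j : K, if ⟨α.src, hi⟩ < j then (Fintype.card F : ℂ) else 1) *
        (Fintype.card F : ℂ) ^ #{k : K | k < ⟨α.tgt, hl⟩}
  have hA : A ≠ 0 := pow_ne_zero _ hq
  have hB : B ≠ 0 := mul_ne_zero (prod_ne_zero_iff.2 fun j _ => by split_ifs <;> simp) (pow_ne_zero _ hq)
  refine ⟨A / B, div_ne_zero hA hB, fun u => ?_⟩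
  obtain ⟨hμ, x, y, hu⟩ := superclassIndex_spec u
  have hu : unitriMatrix u - 1 =
      unitriMatrix x * arcMatrix K (superclassIndex K u) * unitriMatrix y := by
    rw [sub_eq_iff_eq_add']; exact hu
  rw [hu, orbitSum_mul_mul]
  have h := orbitSum_arcMatrix hθ hi hl hμ
  rw [div_mul_eq_mul_div, eq_div_iff hB, mul_comm]
  exact h.symm.trans (by congr!)

end UnitriSuper

/-! ### The inner product as a count of solutions. -/

namespace UnitriSuper

variable {F : Type*} [Field F] [Fintype F] {K : Finset ℕ+} {θ : AddChar F ℂ}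

theorem conj_arcValue (α : Arc F) (μ : Multiset (Arc F)) :
    (starRingEnd ℂ) (arcValue θ K α μ) = arcValue θ K α.bar μ := by
  by_cases h : ∃ β ∈ μ, (α.src = β.src ∧ β.tgt < α.tgt) ∨ (α.src < β.src ∧ β.tgt = α.tgt)
  · have h' : ∃ β ∈ μ, (α.bar.src = β.src ∧ β.tgt < α.bar.tgt) ∨
        (α.bar.src < β.src ∧ β.tgt = α.bar.tgt) := h
    rw [arcValue, arcValue, if_pos h, if_pos h', map_zero]
  · have h' : ¬ ∃ β ∈ μ, (α.bar.src = β.src ∧ β.tgt < α.bar.tgt) ∨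
        (α.bar.src < β.src ∧ β.tgt = α.bar.tgt) := h
    rw [arcValue, arcValue, if_neg h, if_neg h', map_mul, map_div₀, map_pow, map_pow,
      Complex.conj_natCast, ← AddChar.map_neg_eq_conj, ← neg_mul, ← Units.val_neg]
    rfl

theorem superchar_mul_mul_conj (lam mu nu : Multiset (Arc F)) (u : unitri F K) :
    (superchar θ K lam * superchar θ K mu) u * (starRingEnd ℂ) (superchar θ K nu u) =
      superchar θ K (lam + mu + bar nu) u := by
  simp only [Pi.mul_apply, superchar, bar, Multiset.map_add, Multiset.prod_add, Multiset.map_map,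
    map_multiset_prod, Function.comp_def, conj_arcValue]

-- The entries above the diagonal are free. If `B` has a nonzero entry there, shifting u at that
-- position permutes the group and multiplies the sum by some `θ t ≠ 1`, so the sum is zero.
open Classical in
theorem sum_unitri_addChar (hθ : θ ≠ 1) [Fintype (unitri F K)] (B : Matrix K K F) :
    ∑ u : unitri F K, θ (∑ j, ∑ k, B j k * (unitriMatrix u - 1) j k) =
      if ∀ j k, j < k → B j k = 0 then (Fintype.card (unitri F K) : ℂ) else 0 := by
  split_ifs with h
  · rw [sum_congr rfl (g := fun _ => (1 : ℂ)), sum_const, card_univ, nsmul_eq_mul, mul_one]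
    intro u _
    rw [sum_eq_zero, AddChar.map_zero_eq_one]
    intro j _
    refine sum_eq_zero fun k _ => ?_
    by_cases hjk : j < k
    · rw [h j k hjk, zero_mul]
    · rw [sub_one_apply_eq_zero u hjk, mul_zero]
  · push Not at h
    obtain ⟨j, k, hjk, hB⟩ := h
    obtain ⟨t, ht⟩ := AddChar.ne_one_iff.1 hθ
    have hex : ∀ u : unitri F K, ∃ v : unitri F K,
        unitriMatrix v = unitriMatrix u + Matrix.single j k (t / B j k) := fun u => by
      apply exists_unitriMatrix_eq
      · intro a b hab
        rw [Matrix.add_apply, unitriMatrix_of_lt u hab, zero_add, Matrix.single_apply_of_ne]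
        rintro ⟨rfl, rfl⟩
        exact lt_asymm hab hjk
      · intro a
        rw [Matrix.add_apply, unitriMatrix_diag, Matrix.single_apply_of_ne, add_zero]
        rintro ⟨rfl, rfl⟩
        exact lt_irrefl _ hjk
    choose e he using hex
    have hinj : Function.Injective e := fun u v huv => unitriMatrix_injective <| by
      have h1 := he u
      rw [huv, he v] at h1
      exact (add_right_cancel h1).symm
    have hbij : Function.Bijective e := Finite.injective_iff_bijective.1 hinj
    have hval : ∀ u, ∑ a, ∑ b, B a b * (unitriMatrix (e u) - 1) a b =
        t + ∑ a, ∑ b, B a b * (unitriMatrix u - 1) a b := fun u => by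
      have h1 : ∀ a b, B a b * (unitriMatrix (e u) - 1) a b =
          B a b * Matrix.single j k (t / B j k) a b + B a b * (unitriMatrix u - 1) a b := fun a b => by
        rw [he u, Matrix.sub_apply, Matrix.add_apply, Matrix.sub_apply]; ring
      simp only [h1, sum_add_distrib]
      congr 1
      rw [sum_eq_single j, sum_eq_single k, Matrix.single_apply_same, mul_div_cancel₀ _ hB]
      · intro b _ hb
        rw [Matrix.single_apply_of_ne _ _ _ _ _ (fun h => hb h.2.symm), mul_zero]
      · simp
      · intro a _ ha
        refine sum_eq_zero fun b _ => ?_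
        rw [Matrix.single_apply_of_ne _ _ _ _ _ (fun h => ha h.1.symm), mul_zero]
      · simp
    have hS := hbij.sum_comp fun u => θ (∑ a, ∑ b, B a b * (unitriMatrix u - 1) a b)
    simp only [hval, AddChar.map_add_eq_mul] at hS
    rw [← mul_sum] at hS
    have : (θ t - 1) * ∑ u : unitri F K, θ (∑ a, ∑ b, B a b * (unitriMatrix u - 1) a b) = 0 := by
      rw [sub_mul, hS, one_mul, sub_self]
    exact (mul_eq_zero.1 this).resolve_left (sub_ne_zero.2 ht)

variable {D : List (Arc F)} (hs : ∀ α ∈ D, α.src ∈ K) (ht : ∀ α ∈ D, α.tgt ∈ K)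

theorem prod_orbitSum (N : Matrix K K F) :
    ∏ x, orbitSum θ ((diagramSystem hs ht).coeff x) ((diagramSystem hs ht).src x)
        ((diagramSystem hs ht).tgt x) N =
      ∑ v ∈ Fintype.piFinset fun x => leadVectors F ((diagramSystem hs ht).src x) ×ˢ
          trailVectors F ((diagramSystem hs ht).tgt x),
        θ (∑ j, ∑ k, (∑ x, (diagramSystem hs ht).coeff x * (v x).1 j * (v x).2 k) * N j k) := by
  have h : ∀ x, orbitSum θ ((diagramSystem hs ht).coeff x) ((diagramSystem hs ht).src x)
      ((diagramSystem hs ht).tgt x) N = ∑ v ∈ leadVectors F ((diagramSystem hs ht).src x) ×ˢ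
        trailVectors F ((diagramSystem hs ht).tgt x),
        θ ((diagramSystem hs ht).coeff x * (v.1 ⬝ᵥ N *ᵥ v.2)) := fun x =>
    (sum_product _ _ fun v : (K → F) × (K → F) =>
      θ ((diagramSystem hs ht).coeff x * (v.1 ⬝ᵥ N *ᵥ v.2))).symm
  rw [prod_congr rfl fun x _ => h x, prod_univ_sum]
  refine sum_congr rfl fun v _ => ?_
  rw [← addChar_map_sum]
  congr 1
  simp only [dotProduct, Matrix.mulVec, mul_sum, sum_mul]
  rw [sum_comm]
  refine sum_congr rfl fun j _ => ?_
  rw [sum_comm]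
  exact sum_congr rfl fun k _ => sum_congr rfl fun x _ => by ring

/-- After the sums are exchanged, each family of vectors contributes the group order if it solves
the system and zero otherwise. -/
theorem sum_prod_orbitSum_ne_zero_iff (hθ : θ ≠ 1) [Fintype (unitri F K)] :
    ∑ u : unitri F K, ∏ x, orbitSum θ ((diagramSystem hs ht).coeff x) ((diagramSystem hs ht).src x)
        ((diagramSystem hs ht).tgt x) (unitriMatrix u - 1) ≠ 0 ↔
      ∃ P Q, (diagramSystem hs ht).IsSolution P Q := by
  classical
  simp only [prod_orbitSum]
  rw [sum_comm, sum_congr rfl fun v _ => sum_unitri_addChar hθ (Matrix.of fun j k =>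
    ∑ x, (diagramSystem hs ht).coeff x * (v x).1 j * (v x).2 k), ← sum_filter, sum_const, nsmul_eq_mul, mul_ne_zero_iff, Nat.cast_ne_zero, Nat.cast_ne_zero,
    and_iff_left Fintype.card_ne_zero, card_ne_zero]
  constructor
  · rintro ⟨v, hv⟩
    rw [mem_filter, Fintype.mem_piFinset] at hv
    obtain ⟨hv, horth⟩ := hv
    simp only [mem_product, mem_leadVectors, mem_trailVectors] at hv
    refine ⟨fun j x => (v x).1 j, fun k x => (v x).2 k, fun j x hj => ?_, fun k x hk => ?_, horth⟩
    · rcases (not_lt.1 hj).lt_or_eq with h | h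
      · rw [if_neg h.ne']; exact (hv x).1.1 j h
      · rw [if_pos h.symm, h]; exact (hv x).1.2
    · rcases (not_lt.1 hk).lt_or_eq with h | h
      · rw [if_neg h.ne]; exact (hv x).2.1 k h
      · rw [if_pos h, ← h]; exact (hv x).2.2
  · rintro ⟨P, Q, h⟩
    refine ⟨fun x => (fun j => P j x, fun k => Q k x), ?_⟩
    rw [mem_filter, Fintype.mem_piFinset]
    refine ⟨fun x => ?_, h.orth⟩
    simp only [mem_product, mem_leadVectors, mem_trailVectors]
    refine ⟨⟨fun j hj => ?_, ?_⟩, fun k hk => ?_, ?_⟩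
    · rw [h.left j x hj.not_gt, if_neg hj.ne']
    · rw [h.left _ x (lt_irrefl _), if_pos rfl]
    · rw [h.right k x hk.not_gt, if_neg hk.ne]
    · rw [h.right _ x (lt_irrefl _), if_pos rfl]

theorem sum_superchar_ne_zero_iff (hθ : θ ≠ 1) [Fintype (unitri F K)] :
    ∑ u, superchar θ K (D : Multiset (Arc F)) u ≠ 0 ↔
      ∃ P Q, (diagramSystem hs ht).IsSolution P Q := by
  have h : ∀ x : Fin D.length, ∃ C : ℂ, C ≠ 0 ∧ ∀ u : unitri F K,
      arcValue θ K (D.get x) (superclassIndex K u) = C * orbitSum θ ((diagramSystem hs ht).coeff x)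
        ((diagramSystem hs ht).src x) ((diagramSystem hs ht).tgt x) (unitriMatrix u - 1) := fun x =>
    exists_arcValue_eq_mul_orbitSum hθ (hs _ (D.get_mem x)) (ht _ (D.get_mem x))
  choose C hC hval using h
  rw [← sum_prod_orbitSum_ne_zero_iff hs ht hθ]
  simp only [superchar, prod_map_coe_list, hval, prod_mul_distrib, ← mul_sum]
  rw [mul_ne_zero_iff, and_iff_right (prod_ne_zero_iff.2 fun x _ => hC x)]

end UnitriSuper

/-! ### The theorem. -/

open UnitriSuper in
theorem theorem4p1 {F : Type*} [Field F] [Fintype F] (θ : AddChar F ℂ) (hθ : θ ≠ 1)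
    (K : Finset ℕ+) (lam mu nu : Multiset (Arc F))
    (hlam : IsQSetPartition K lam) (hmu : IsQSetPartition K mu) (hnu : IsQSetPartition K nu)
    (D : List (Arc F)) (hD : (D : Multiset (Arc F)) = lam + mu + bar nu) :
    charInner (superchar θ K lam * superchar θ K mu) (superchar θ K nu) ≠ 0 ↔
      HasCompleteMatching K D := by
  have hmem : ∀ α ∈ D, α ∈ lam ∨ α ∈ mu ∨ ∃ β ∈ nu, β.bar = α := fun α hα => by
    have : α ∈ lam + mu + bar nu := hD ▸ Multiset.mem_coe.2 hα
    rw [Multiset.mem_add, Multiset.mem_add, bar, Multiset.mem_map] at this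
    tauto
  have hs : ∀ α ∈ D, α.src ∈ K := fun α hα => by
    rcases hmem α hα with h | h | ⟨β, h, rfl⟩
    exacts [hlam.src_mem α h, hmu.src_mem α h, hnu.src_mem β h]
  have ht : ∀ α ∈ D, α.tgt ∈ K := fun α hα => by
    rcases hmem α hα with h | h | ⟨β, h, rfl⟩
    exacts [hlam.tgt_mem α h, hmu.tgt_mem α h, hnu.tgt_mem β h]
  have : Fintype (unitri F K) := Fintype.ofFinite _
  rw [hasCompleteMatching_iff_exists_isSolution hs ht, ← sum_superchar_ne_zero_iff hs ht hθ,
    charInner, finsum_eq_sum_of_fintype, hD]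
  simp only [superchar_mul_mul_conj]
  rw [mul_ne_zero_iff, and_iff_right]
  simp
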